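/- Let $\mathbb O=\mathbb R^8$ be the octonions with basis $e_0,\dots,e_7$, unit $e_0$, and $e_ie_j=-\delta_{ij}e_0+\sum_k\epsilon_{ijk}e_k$ for $i,j\ge 1$, where $\epsilon$ is completely antisymmetric with value $1$ for $ijk=123,145,176,246,257,347,365$, and with the norm $\|x\|^2=\sum_j x_j^2$. Let $\mathbb S^{15}\subset\mathbb O^2$ be the unit sphere, let $\pi:\mathbb S^{15}\to\mathbb{OP}^1=\mathbb O\cup\{\infty\}$, $\pi(x,y)=[x:y]=y^{-1}x$ (with $\pi(x,0)=\infty$), be the octonionic Hopf fibration, and let $L=\triangle_{\mathbb S^{15}}-\triangle_{\mathcal V}$ be its sub-Laplacian, where $\triangle_{\mathbb S^{15}}$ is the Laplace–Beltrami operator of $\mathbb S^{15}$ and the vertical Laplacian $\triangle_{\mathcal V}$ is the Laplace–Beltrami operator along the fibers of $\pi$: $(\triangle_{\mathcal V}g)(z)=\big(\triangle_{\pi^{-1}(\pi(z))}\,g|_{\pi^{-1}(\pi(z))}\big)(z)$. Let $p=e_0\in\mathbb S^7\subset\mathbb O$, let $Y_1,\dots,Y_7$ be an orthonormal basis of $T_p\mathbb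 S^7$, and let $\exp_p$ be the Riemannian exponential map of $\mathbb S^7$ at $p$. The cylindrical coordinates $$(w,\theta)\mapsto\left(\frac{\exp_p(\sum_i\theta_iY_i)\,w}{\sqrt{1+\|w\|^2}},\ \frac{\exp_p(\sum_i\theta_iY_i)}{\sqrt{1+\|w\|^2}}\right),\qquad w\in\mathbb O,\ \theta\in\mathbb R^7,\ \|\theta\|<\pi,$$ parametrize $\Omega=\{(x,y)\in\mathbb S^{15}: y\ne0,\ y/\|y\|\ne -p\}$. Let $\psi:\Omega\to[0,\pi/2)\times[0,\pi)$ send the point with coordinates $(w,\theta)$ to $(r,\eta)=(\arctan\|w\|,\|\theta\|)$. Let $\mathcal D$ be the space of smooth compactly supported functions on $[0,\pi/2)\times[0,\pi)$, and put $$\widetilde L=\frac{\partial^2}{\partial r^2}+(7\cot r-7\tan r)\frac{\partial}{\partial r}+\tan^2 r\left(\frac{\partial^2}{\partial\eta^2}+6\cot\eta\frac{\partial}{\partial\eta}\right)\quad\text{on }(0,\pi/2)\times(0,\pi).$$ **Proposition.** The radial part of $L$ is $\widetilde L$. That is, for every $f\in\mathcal D$, $$L(f\circ\psi)=(\widetilde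 Lf)\circ\psi\quad\text{at all points of }\Omega\text{ with } r>0 \text{ and } \eta>0,$$ and any operator $T$ from $\mathcal D$ to functions of $(r,\eta)$ such that $L(f\circ\psi)=(Tf)\circ\psi$ at these points for all $f\in\mathcal D$ satisfies $Tf=\widetilde Lf$ on $(0,\pi/2)\times(0,\pi)$ for all $f\in\mathcal D$. Moreover the identity extends to the points with $r=0$ or $\eta=0$ in the following sense: if $f\in\mathcal D$, $z\in\Omega$, and $f\circ\psi$ is $C^2$ near $z$, then $(\widetilde Lf)(r,\eta)\to L(f\circ\psi)(z)$ as $(r,\eta)\to\psi(z)$ within $(0,\pi/2)\times(0,\pi)$. -/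

import Mathlib

open Set Filter Topology
open scoped ContDiff

noncomputable section

namespace OctonionicHopf

/-! Riemannian geometry of submanifolds of a Euclidean space, with the induced metric. -/

section Submanifold

variable {E : Type*} [NormedAddCommGroup E] [InnerProductSpace ℝ E]

/-- The tangent space at `p` of a submanifold `M` of a Euclidean space `E`, generated by the
velocities of the smooth curves that stay in `M`. -/
def tangent (M : Set E) (p : E) : Submodule ℝ E :=
  Submodule.span ℝ {v | ∃ γ : ℝ → E,
    ContDiff ℝ ∞ γ ∧ (∀ t, γ t ∈ M) ∧ γ 0 = p ∧ deriv γ 0 = v}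

/-- `γ : ℝ → M` is a geodesic for the induced metric: its covariant acceleration, that is, the
tangential part of its acceleration in `E`, vanishes. -/
def IsGeodesic (M : Set E) (γ : ℝ → E) : Prop :=
  ContDiff ℝ ∞ γ ∧ (∀ t, γ t ∈ M) ∧
    ∀ t, ∀ v ∈ tangent M (γ t), inner ℝ (deriv (deriv γ) t) v = 0

open Classical in
/-- The geodesic of the (complete) submanifold `M` that starts at `p` with velocity `v`. -/
def geodesic (M : Set E) (p v : E) : ℝ → E :=
  if h : ∃ γ : ℝ → E, IsGeodesic M γ ∧ γ 0 = p ∧ deriv γ 0 = v then Classical.choose h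
  else fun _ => p

/-- The Riemannian exponential map of `M` at `p`. -/
def expMap (M : Set E) (p v : E) : E := geodesic M p v 1

/-- The Laplace-Beltrami operator of `M`, the trace of the Riemannian Hessian: the sum of the
second derivatives of `g` at `p` along the geodesics that start at `p` in the directions of an
orthonormal basis of the tangent space of `M` at `p`. -/
def laplaceBeltrami [FiniteDimensional ℝ E] (M : Set E) (g : E → ℝ) (p : E) : ℝ :=
  ∑ i, iteratedDeriv 2 (fun t => g (geodesic M p (stdOrthonormalBasis ℝ (tangent M p) i : E) t)) 0

end Submanifold

/-! Octonions. -/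

/-- The octonions `x = ∑ x_j e_j`, with the norm `‖x‖² = ∑ x_j²`. -/
abbrev Oct : Type := EuclideanSpace ℝ (Fin 8)

/-- The triples `ijk` with `ε_{ijk} = 1`, up to cyclic permutations. -/
def octTriples : List (Fin 8 × Fin 8 × Fin 8) :=
  [(1, 2, 3), (1, 4, 5), (1, 7, 6), (2, 4, 6), (2, 5, 7), (3, 4, 7), (3, 6, 5)]

/-- The completely antisymmetric tensor `ε_{ijk}`. -/
def octEps (i j k : Fin 8) : ℤ :=
  if (i, j, k) ∈ octTriples ∨ (j, k, i) ∈ octTriples ∨ (k, i, j) ∈ octTriples then 1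
  else if (j, i, k) ∈ octTriples ∨ (i, k, j) ∈ octTriples ∨ (k, j, i) ∈ octTriples then -1
  else 0

/-- The coefficient of `e_k` in the product `e_i e_j`. -/
def octCoeff (i j k : Fin 8) : ℤ :=
  if i = 0 then (if k = j then 1 else 0)
  else if j = 0 then (if k = i then 1 else 0)
  else (if i = j ∧ k = 0 then -1 else 0) + octEps i j k

/-- The product of two octonions. -/
def octMul (x y : Oct) : Oct :=
  WithLp.toLp 2 fun k => ∑ i, ∑ j, (octCoeff i j k : ℝ) * (x i * y j)

/-- The conjugate of an octonion. -/
def octConj (x : Oct) : Oct := WithLp.toLp 2 fun k => if k = 0 then x k else -x k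

/-- The inverse of an octonion (for `x ≠ 0`). -/
def octInv (x : Oct) : Oct := (‖x‖ ^ 2)⁻¹ • octConj x

/-! The octonionic Hopf fibration. -/

/-- `𝕆²` with the norm `‖(x, y)‖² = ‖x‖² + ‖y‖²`. -/
abbrev Oct2 : Type := WithLp 2 (Oct × Oct)

/-- The unit sphere of `𝕆²`. -/
def S15 : Set Oct2 := Metric.sphere 0 1

/-- The unit sphere of `𝕆`. -/
def S7 : Set Oct := Metric.sphere 0 1

/-- The pole `(1, 0, …, 0)` of `S7`. -/
def pole : Oct := EuclideanSpace.single 0 1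

/-- The octonionic Hopf map `(x, y) ↦ [x : y] = y⁻¹ x`, with values in
`𝕆P¹ = 𝕆 ∪ {∞}`. -/
def hopf (z : Oct2) : OnePoint Oct :=
  open Classical in
  if z.snd = 0 then OnePoint.infty else ((octMul (octInv z.snd) z.fst : Oct) : OnePoint Oct)

/-- The fiber of the Hopf fibration through the point `z`. -/
def fiber (z : Oct2) : Set Oct2 := {z' | z' ∈ S15 ∧ hopf z' = hopf z}

/-- The vertical Laplacian: the Laplace-Beltrami operator along the fibers. -/
def verticalLaplacian (g : Oct2 → ℝ) (z : Oct2) : ℝ := laplaceBeltrami (fiber z) g z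

/-- The sub-Laplacian `L = Δ_{S¹⁵} - Δ_𝒱`. -/
def subLaplacian (g : Oct2 → ℝ) (z : Oct2) : ℝ :=
  laplaceBeltrami S15 g z - verticalLaplacian g z

/-! Cylindrical coordinates, with respect to an orthonormal basis `Y` of the tangent space of `S7`
at the pole. -/

/-- The point of `S15` with cylindrical coordinates `(w, θ)`. -/
def cylPoint (Y : OrthonormalBasis (Fin 7) ℝ (tangent S7 pole))
    (c : Oct × EuclideanSpace ℝ (Fin 7)) : Oct2 :=
  let u : Oct := expMap S7 pole (∑ i, c.2 i • (Y i : Oct))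
  (√(1 + ‖c.1‖ ^ 2))⁻¹ • WithLp.toLp 2 (octMul u c.1, u)

/-- The range of the cylindrical coordinates `(w, θ)`: `w ∈ 𝕆` and `‖θ‖ < π`. -/
def cylDomain : Set (Oct × EuclideanSpace ℝ (Fin 7)) := {c | ‖c.2‖ < Real.pi}

/-- The domain `Ω` of the cylindrical coordinates. -/
def Omega : Set Oct2 := {z | z ∈ S15 ∧ z.snd ≠ 0 ∧ ‖z.snd‖⁻¹ • z.snd ≠ -pole}

/-- The map `ψ` that sends the point with cylindrical coordinates `(w, θ)` to
`(r, η) = (arctan ‖w‖, ‖θ‖)`. -/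
def psi (Y : OrthonormalBasis (Fin 7) ℝ (tangent S7 pole)) (z : Oct2) : ℝ × ℝ :=
  let c := Function.invFunOn (cylPoint Y) cylDomain z
  (Real.arctan ‖c.1‖, ‖c.2‖)

/-- The range `[0, π/2) × [0, π)` of `(r, η)`. -/
def radialDomain : Set (ℝ × ℝ) := Ico 0 (Real.pi / 2) ×ˢ Ico 0 Real.pi

/-- Its interior `(0, π/2) × (0, π)`, on which `cot r` and `cot η` are defined. -/
def radialInterior : Set (ℝ × ℝ) := Ioo 0 (Real.pi / 2) ×ˢ Ioo 0 Real.pi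

/-- The space `𝒟` of smooth, compactly supported functions on `[0, π/2) × [0, π)`
(the values elsewhere are irrelevant). -/
def testFunctions : Set (ℝ × ℝ → ℝ) :=
  {f | ContDiffOn ℝ ∞ f radialDomain ∧
    ∃ K ⊆ radialDomain, IsCompact K ∧ ∀ q ∈ radialDomain \ K, f q = 0}

/-- `T` is a radial part of `L`: `L (f ∘ ψ) = (T f) ∘ ψ` for all `f ∈ 𝒟`, at the points of
`Ω` where `r > 0` and `η > 0` (elsewhere `f ∘ ψ` need not be differentiable). -/
def IsRadialPart (Y : OrthonormalBasis (Fin 7) ℝ (tangent S7 pole))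
    (T : (ℝ × ℝ → ℝ) → ℝ × ℝ → ℝ) : Prop :=
  ∀ f ∈ testFunctions, ∀ z ∈ Omega, psi Y z ∈ radialInterior →
    subLaplacian (f ∘ psi Y) z = T f (psi Y z)

/-- The operator
`∂²/∂r² + (7 cot r - 7 tan r) ∂/∂r + tan² r (∂²/∂η² + 6 cot η ∂/∂η)`. -/
def radialOp (f : ℝ × ℝ → ℝ) (q : ℝ × ℝ) : ℝ :=
  iteratedDeriv 2 (fun r => f (r, q.2)) q.1
    + (7 * Real.cot q.1 - 7 * Real.tan q.1) * deriv (fun r => f (r, q.2)) q.1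
    + Real.tan q.1 ^ 2 *
      (iteratedDeriv 2 (fun η => f (q.1, η)) q.2
        + 6 * Real.cot q.2 * deriv (fun η => f (q.1, η)) q.2)

end OctonionicHopf

end

/-! The proof replaces curved Laplacians by traces of a Euclidean Hessian. Geodesics on the unit
sphere of a subspace `V` are great circles, with acceleration `-p` when they leave `p` at unit
speed. Let `F` be the extension of a function on the sphere that is homogeneous of degree zero. It
is constant along the ray through `p`, so its radial derivatives of first and second order vanish,
and the Laplace-Beltrami operator becomes the trace over `V` of the Hessian of `F`
(`laplaceBeltrami_subsphere`).

The Hopf fibers are such spheres too: by left cancellation in the octonions, `y⁻¹ x = w` means `x =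
y w`, a linear condition on `(x, y)` (`fiber_eq_subsphere`). Hence `L` is the Hessian trace over
`𝕆²` minus the trace over the octonionic line through the point (`subLaplacian_eq_sum`).

On `Ω`, `ψ(x, y) = (arctan (‖x‖/‖y‖), arccos (y₀/‖y‖))` (`psi_eq_radialMap`). `subLaplacian_radial`
evaluates the traces in orthonormal bases adapted to `x`, `y` and the pole, where each Hessian term
is a second derivative along a straight line. The seven directions orthogonal to `x` give `7 cot r`,
the seven orthogonal to `y` give `-7 tan r`. Motion inside the octonionic line leaves `r` fixed, and
subtracting its contribution turns the factor `1/cos² r` of the `η`-terms into `tan² r`.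

Uniqueness follows because `ψ` attains every value in the open rectangle. For the limit, the trace
formula is continuous at `z` when `F` is `C²` there, and `radialSection` supplies a continuous
section of `ψ` through `z`, along which the formula is compared with `radialOp f`. -/

noncomputable section

namespace OctonionicHopf

/-! ### Second derivatives along curves and lines. -/

section Calculus

variable {E : Type*} [NormedAddCommGroup E] [NormedSpace ℝ E]

/-- The second order chain rule along a curve. -/
theorem iteratedDeriv_two_comp_curve {F : E → ℝ} {c c₁ : ℝ → E} {c₂ : E} {t₀ : ℝ}
    (hF : ContDiffAt ℝ 2 F (c t₀)) (hc : ∀ᶠ t in 𝓝 t₀, HasDerivAt c (c₁ t) t)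
    (hc₁ : HasDerivAt c₁ c₂ t₀) :
    iteratedDeriv 2 (fun t => F (c t)) t₀ =
      fderiv ℝ (fderiv ℝ F) (c t₀) (c₁ t₀) (c₁ t₀) + fderiv ℝ F (c t₀) c₂ := by
  have hcont : ContinuousAt c t₀ := hc.self_of_nhds.continuousAt
  have h1 : ∀ᶠ x in 𝓝 (c t₀), DifferentiableAt ℝ F x := by
    filter_upwards [hF.eventually (by simp)] with x hx
    exact hx.differentiableAt (by simp)
  have h2 : deriv (fun t => F (c t)) =ᶠ[𝓝 t₀] fun t => fderiv ℝ F (c t) (c₁ t) := by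
    filter_upwards [hc, hcont.eventually h1] with t ht hx
    exact (hx.hasFDerivAt.comp_hasDerivAt t ht).deriv
  rw [iteratedDeriv_succ, iteratedDeriv_one, h2.deriv_eq]
  have h3 : HasFDerivAt (fderiv ℝ F) (fderiv ℝ (fderiv ℝ F) (c t₀)) (c t₀) :=
    ((hF.fderiv_right (m := 1) (by norm_num)).differentiableAt (by simp)).hasFDerivAt
  exact ((h3.comp_hasDerivAt t₀ hc.self_of_nhds).clm_apply hc₁).deriv

theorem iteratedDeriv_two_comp_line {F : E → ℝ} {p : E} (hF : ContDiffAt ℝ 2 F p) (v : E) :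
    iteratedDeriv 2 (fun t : ℝ => F (p + t • v)) 0 = fderiv ℝ (fderiv ℝ F) p v v := by
  have h := iteratedDeriv_two_comp_curve (F := F) (c := fun t : ℝ => p + t • v)
    (c₁ := fun _ => v) (c₂ := 0) (t₀ := 0) (by simpa using hF)
    (Eventually.of_forall fun t => by
      simpa using ((hasDerivAt_id t).smul_const v).const_add p) (hasDerivAt_const _ _)
  simpa using h

end Calculus

/-! ### Geodesics and Laplacian of the unit sphere of a subspace. -/

section UnitSphere

variable {E : Type*} [NormedAddCommGroup E] [InnerProductSpace ℝ E]

/-- The unit sphere of a subspace. -/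
def subsphere (V : Submodule ℝ E) : Set E := {p | p ∈ V ∧ ‖p‖ = 1}

/-- The great circle through `p` with initial velocity `v`. -/
def greatCircle (p v : E) (t : ℝ) : E :=
  Real.cos (‖v‖ * t) • p + (Real.sin (‖v‖ * t) / ‖v‖) • v

theorem hasDerivAt_greatCircle (p v : E) (t : ℝ) :
    HasDerivAt (greatCircle p v)
      ((-(‖v‖ * Real.sin (‖v‖ * t))) • p + Real.cos (‖v‖ * t) • v) t := by
  have hl : HasDerivAt (fun t : ℝ => ‖v‖ * t) ‖v‖ t := by
    simpa using (hasDerivAt_id t).const_mul ‖v‖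
  refine (((hl.cos).smul_const p).add (((hl.sin).div_const ‖v‖).smul_const v)).congr_deriv ?_
  -- For `v = 0` the quotient by `‖v‖` takes the default value `0`, which is harmless since it
  -- multiplies `v`.
  rcases eq_or_ne v 0 with rfl | hv
  · simp
  · congr 2
    · ring
    · field_simp [norm_ne_zero_iff.2 hv]

theorem hasDerivAt_deriv_greatCircle (p v : E) (t : ℝ) :
    HasDerivAt (fun t => (-(‖v‖ * Real.sin (‖v‖ * t))) • p + Real.cos (‖v‖ * t) • v)
      (-(‖v‖ ^ 2) • greatCircle p v t) t := by
  have hl : HasDerivAt (fun t : ℝ => ‖v‖ * t) ‖v‖ t := by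
    simpa using (hasDerivAt_id t).const_mul ‖v‖
  refine ((((hl.sin).const_mul ‖v‖).neg.smul_const p).add
    ((hl.cos).smul_const v)).congr_deriv ?_
  rw [greatCircle, smul_add, smul_smul, smul_smul]
  rcases eq_or_ne v 0 with rfl | hv
  · simp
  · congr 2
    · ring
    · field_simp [norm_ne_zero_iff.2 hv]

theorem contDiff_greatCircle (p v : E) : ContDiff ℝ ∞ (greatCircle p v) := by
  unfold greatCircle
  fun_prop

@[simp] theorem greatCircle_zero (p v : E) : greatCircle p v 0 = p := by simp [greatCircle]

theorem greatCircle_mem {V : Submodule ℝ E} {p v : E} (hp : p ∈ subsphere V) (hv : v ∈ V)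
    (hpv : inner ℝ p v = 0) (t : ℝ) : greatCircle p v t ∈ subsphere V := by
  refine ⟨V.add_mem (V.smul_mem _ hp.1) (V.smul_mem _ hv), ?_⟩
  rw [← sq_eq_sq₀ (norm_nonneg _) zero_le_one, greatCircle, norm_add_sq_real, inner_smul_left,
    inner_smul_right, hpv, norm_smul, norm_smul, mul_pow, mul_pow, hp.2, Real.norm_eq_abs,
    Real.norm_eq_abs, sq_abs, sq_abs]
  rcases eq_or_ne v 0 with rfl | hv
  · simp
  · have := Real.sin_sq_add_cos_sq (‖v‖ * t)
    field_simp [norm_ne_zero_iff.2 hv]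
    simp
    linear_combination ‖v‖ * this

/-- `V` is its own double orthogonal complement, and the pairing of `γ` with a vector of `Vᗮ` is
constantly zero. -/
theorem deriv_mem_of_forall_mem [FiniteDimensional ℝ E] {V : Submodule ℝ E} {γ : ℝ → E} {v : E}
    {t : ℝ} (hγ : ∀ t, γ t ∈ V) (h : HasDerivAt γ v t) : v ∈ V := by
  rw [← V.orthogonal_orthogonal, Submodule.mem_orthogonal]
  intro u hu
  have h1 : HasDerivAt (fun t => inner ℝ u (γ t)) (inner ℝ u v) t := by
    simpa using (hasDerivAt_const t u).inner ℝ h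
  have h2 : (fun t => inner ℝ u (γ t)) = fun _ => (0 : ℝ) := by
    funext s
    exact (Submodule.mem_orthogonal' V u).1 hu _ (hγ s)
  rw [h2] at h1
  exact h1.unique (hasDerivAt_const _ _)

theorem inner_deriv_of_norm_eq_one {γ : ℝ → E} {v : E} {t : ℝ} (hγ : ∀ t, ‖γ t‖ = 1)
    (h : HasDerivAt γ v t) : inner ℝ (γ t) v = 0 := by
  have h1 := h.inner ℝ h
  have h2 : (fun t => inner ℝ (γ t) (γ t)) = fun _ => (1 : ℝ) := by
    funext s
    rw [real_inner_self_eq_norm_sq, hγ]; norm_num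
  rw [h2, real_inner_comm (γ t) v] at h1
  have := h1.unique (hasDerivAt_const _ _)
  linarith

theorem mem_tangent_subsphere [FiniteDimensional ℝ E] {V : Submodule ℝ E} {p : E}
    (hp : p ∈ subsphere V) (v : E) :
    v ∈ tangent (subsphere V) p ↔ v ∈ V ∧ inner ℝ p v = 0 := by
  constructor
  · intro h
    have : tangent (subsphere V) p ≤ V ⊓ (ℝ ∙ p)ᗮ := by
      refine Submodule.span_le.2 ?_
      rintro w ⟨γ, hγ, hM, rfl, rfl⟩
      have hd := ((hγ.differentiable (by simp)) 0).hasDerivAt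
      exact ⟨deriv_mem_of_forall_mem (fun t => (hM t).1) hd,
        Submodule.mem_orthogonal_singleton_iff_inner_right.2
          (inner_deriv_of_norm_eq_one (fun t => (hM t).2) hd)⟩
    exact ⟨(this h).1, Submodule.mem_orthogonal_singleton_iff_inner_right.1 (this h).2⟩
  · rintro ⟨hv, hpv⟩
    refine Submodule.subset_span ⟨greatCircle p v, contDiff_greatCircle p v,
      greatCircle_mem hp hv hpv, greatCircle_zero p v, ?_⟩
    simpa using (hasDerivAt_greatCircle p v 0).deriv

theorem isGeodesic_greatCircle [FiniteDimensional ℝ E] {V : Submodule ℝ E} {p v : E}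
    (hp : p ∈ subsphere V) (hv : v ∈ V) (hpv : inner ℝ p v = 0) :
    IsGeodesic (subsphere V) (greatCircle p v) := by
  refine ⟨contDiff_greatCircle p v, greatCircle_mem hp hv hpv, fun t u hu => ?_⟩
  rw [funext fun t => (hasDerivAt_greatCircle p v t).deriv,
    (hasDerivAt_deriv_greatCircle p v t).deriv, inner_smul_left,
    ((mem_tangent_subsphere (greatCircle_mem hp hv hpv t) u).1 hu).2, mul_zero]

/-- Geodesics of a unit sphere satisfy the equation of the harmonic oscillator. -/
theorem IsGeodesic.deriv_deriv_eq [FiniteDimensional ℝ E] {V : Submodule ℝ E} {γ : ℝ → E}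
    (hγ : IsGeodesic (subsphere V) γ) (t : ℝ) :
    deriv (deriv γ) t = -(‖deriv γ 0‖ ^ 2) • γ t := by
  obtain ⟨hs, hM, hg⟩ := hγ
  have hd : ∀ t, HasDerivAt γ (deriv γ t) t := fun t =>
    ((hs.differentiable (by simp)) t).hasDerivAt
  have hd2 : ∀ t, HasDerivAt (deriv γ) (deriv (deriv γ) t) t := fun t =>
    (((contDiff_infty_iff_deriv.1 hs).2.differentiable (by simp)) t).hasDerivAt
  have hV : ∀ t, deriv γ t ∈ V := fun t => deriv_mem_of_forall_mem (fun s => (hM s).1) (hd t)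
  have hV2 : ∀ t, deriv (deriv γ) t ∈ V := fun t => deriv_mem_of_forall_mem hV (hd2 t)
  have horth : ∀ t, inner ℝ (γ t) (deriv γ t) = 0 := fun t =>
    inner_deriv_of_norm_eq_one (fun s => (hM s).2) (hd t)
  -- The speed is constant, since the velocity is tangent and the acceleration is orthogonal to
  -- tangent vectors.
  have hspeed : ∀ t, inner ℝ (deriv γ t) (deriv γ t) = ‖deriv γ 0‖ ^ 2 := by
    intro t
    rw [← real_inner_self_eq_norm_sq]
    refine is_const_of_deriv_eq_zero (f := fun t => inner ℝ (deriv γ t) (deriv γ t))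
      (fun t => ((hd2 t).inner ℝ (hd2 t)).differentiableAt) (fun t => ?_) t 0
    rw [((hd2 t).inner ℝ (hd2 t)).deriv, real_inner_comm (deriv (deriv γ) t) (deriv γ t),
      hg t _ ((mem_tangent_subsphere (hM t) _).2 ⟨hV t, horth t⟩), add_zero]
  have hacc : inner ℝ (γ t) (deriv (deriv γ) t) = -(‖deriv γ 0‖ ^ 2) := by
    have h1 := (hd t).inner ℝ (hd2 t)
    rw [funext horth] at h1
    have := h1.unique (hasDerivAt_const _ _)
    rw [hspeed] at this
    linarith
  set a := deriv (deriv γ) t with ha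
  have hself : inner ℝ (γ t) (γ t) = (1 : ℝ) := by
    rw [real_inner_self_eq_norm_sq, (hM t).2]; norm_num
  -- The part of the acceleration orthogonal to `γ t` is tangent, hence orthogonal both to `a` and
  -- to `γ t`, hence to itself.
  have hu : a - inner ℝ (γ t) a • γ t ∈ tangent (subsphere V) (γ t) := by
    rw [mem_tangent_subsphere (hM t)]
    refine ⟨V.sub_mem (hV2 t) (V.smul_mem _ (hM t).1), ?_⟩
    rw [inner_sub_right, inner_smul_right, hself, mul_one, sub_self]
  have h0 : inner ℝ (a - inner ℝ (γ t) a • γ t) (a - inner ℝ (γ t) a • γ t) = (0 : ℝ) := by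
    nth_rewrite 1 [inner_sub_left]
    rw [hg t _ hu, inner_smul_left, ((mem_tangent_subsphere (hM t) _).1 hu).2]
    simp
  rw [← hacc]
  exact sub_eq_zero.1 (inner_self_eq_zero.1 h0)

/-- Both curves solve the same harmonic oscillator equation with the same initial data. The energy
of their difference is conserved and starts at zero, which forces the velocities to agree. -/
theorem IsGeodesic.eq_greatCircle [FiniteDimensional ℝ E] {V : Submodule ℝ E} {γ : ℝ → E}
    (hγ : IsGeodesic (subsphere V) γ) : γ = greatCircle (γ 0) (deriv γ 0) := by
  set p := γ 0
  set v := deriv γ 0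
  have hd : ∀ t, HasDerivAt γ (deriv γ t) t := fun t =>
    ((hγ.1.differentiable (by simp)) t).hasDerivAt
  have hd2 : ∀ t, HasDerivAt (deriv γ) (-(‖v‖ ^ 2) • γ t) t := fun t =>
    (((contDiff_infty_iff_deriv.1 hγ.1).2.differentiable (by simp)) t).hasDerivAt.congr_deriv
      (hγ.deriv_deriv_eq t)
  have hδ : ∀ t, HasDerivAt (fun t => γ t - greatCircle p v t) _ t := fun t =>
    (hd t).sub (hasDerivAt_greatCircle p v t)
  have hδ2 : ∀ t, HasDerivAt (fun t => deriv γ t -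
      ((-(‖v‖ * Real.sin (‖v‖ * t))) • p + Real.cos (‖v‖ * t) • v))
      (-(‖v‖ ^ 2) • (γ t - greatCircle p v t)) t := fun t =>
    ((hd2 t).sub (hasDerivAt_deriv_greatCircle p v t)).congr_deriv (smul_sub _ _ _).symm
  set δ := fun t => γ t - greatCircle p v t
  set δ₁ := fun t => deriv γ t - ((-(‖v‖ * Real.sin (‖v‖ * t))) • p + Real.cos (‖v‖ * t) • v)
  have hδ1_zero : δ₁ 0 = 0 := by simp [δ₁, v]
  have hδ_zero : δ 0 = 0 := by simp [δ, p]
  have henergy : ∀ t, ‖v‖ ^ 2 * inner ℝ (δ t) (δ t) + inner ℝ (δ₁ t) (δ₁ t) = 0 := by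
    intro t
    have hE : ∀ t, HasDerivAt
        (fun t => ‖v‖ ^ 2 * inner ℝ (δ t) (δ t) + inner ℝ (δ₁ t) (δ₁ t)) 0 t := fun t => by
      refine ((((hδ t).inner ℝ (hδ t)).const_mul (‖v‖ ^ 2)).add
        ((hδ2 t).inner ℝ (hδ2 t))).congr_deriv ?_
      simp only [inner_smul_left, inner_smul_right]
      change ‖v‖ ^ 2 * (inner ℝ (δ t) (δ₁ t) + inner ℝ (δ₁ t) (δ t)) +
        (-(‖v‖ ^ 2) * inner ℝ (δ₁ t) (δ t) + -(‖v‖ ^ 2) * inner ℝ (δ t) (δ₁ t)) = 0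
      ring
    have := is_const_of_deriv_eq_zero (fun t => (hE t).differentiableAt)
      (fun t => (hE t).deriv) t 0
    simpa [hδ1_zero, hδ_zero] using this
  have hδ1 : ∀ t, δ₁ t = 0 := fun t => by
    have h1 := henergy t
    have h2 : 0 ≤ ‖v‖ ^ 2 * inner ℝ (δ t) (δ t) := mul_nonneg (sq_nonneg _) real_inner_self_nonneg
    have h3 : 0 ≤ inner ℝ (δ₁ t) (δ₁ t) := real_inner_self_nonneg
    exact inner_self_eq_zero.1 (by linarith : inner ℝ (δ₁ t) (δ₁ t) = 0)
  funext t
  have := is_const_of_deriv_eq_zero (fun t => (hδ t).differentiableAt)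
    (fun t => (hδ t).deriv.trans (hδ1 t)) t 0
  exact sub_eq_zero.1 (this.trans hδ_zero)

/-- Existence comes from the great circle, and uniqueness identifies whichever curve the choice in
`geodesic` returns. -/
theorem geodesic_subsphere [FiniteDimensional ℝ E] {V : Submodule ℝ E} {p v : E}
    (hp : p ∈ subsphere V) (hv : v ∈ V) (hpv : inner ℝ p v = 0) :
    geodesic (subsphere V) p v = greatCircle p v := by
  have h : ∃ γ : ℝ → E, IsGeodesic (subsphere V) γ ∧ γ 0 = p ∧ deriv γ 0 = v :=
    ⟨greatCircle p v, isGeodesic_greatCircle hp hv hpv, greatCircle_zero p v, by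
      simpa using (hasDerivAt_greatCircle p v 0).deriv⟩
  rw [geodesic, dif_pos h]
  obtain ⟨h1, h2, h3⟩ := Classical.choose_spec h
  rw [h1.eq_greatCircle, h2, h3]

theorem sum_bilin_eq_sum_frame [FiniteDimensional ℝ E] {ι : Type*} [Fintype ι]
    (B : E →L[ℝ] E →L[ℝ] ℝ) (v : ι → E) :
    ∑ i, B (v i) (v i) = ∑ k, B (stdOrthonormalBasis ℝ E k)
      (∑ i, inner ℝ (v i) (stdOrthonormalBasis ℝ E k) • v i) := by
  simp only [map_sum, map_smul]
  rw [Finset.sum_comm]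
  refine Finset.sum_congr rfl fun i _ => ?_
  conv_lhs => enter [1, 2]; rw [← (stdOrthonormalBasis ℝ E).sum_repr' (v i)]
  simp only [map_sum, map_smul, sum_apply, smul_apply]
  exact Finset.sum_congr rfl fun k _ => by rw [real_inner_comm]

/-- The trace of a bilinear form over a family of vectors is determined by the frame operator. -/
theorem sum_bilin_eq_of_frame [FiniteDimensional ℝ E] {ι κ : Type*} [Fintype ι] [Fintype κ]
    (B : E →L[ℝ] E →L[ℝ] ℝ) (v : ι → E) (w : κ → E)
    (h : ∀ x : E, ∑ i, inner ℝ (v i) x • v i = ∑ j, inner ℝ (w j) x • w j) :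
    ∑ i, B (v i) (v i) = ∑ j, B (w j) (w j) := by
  rw [sum_bilin_eq_sum_frame B v, sum_bilin_eq_sum_frame B w]
  exact Finset.sum_congr rfl fun k _ => by rw [h]

/-- The Laplace-Beltrami operator of the unit sphere of a subspace `V`, applied to a function with a
`C²` extension `F` that is homogeneous of degree zero: the trace over `V` of the second
derivative of `F`. -/
theorem laplaceBeltrami_subsphere [FiniteDimensional ℝ E] {V : Submodule ℝ E} {p : E}
    (hp : p ∈ subsphere V) {g F : E → ℝ} (hgF : ∀ x, ‖x‖ = 1 → g x = F x)
    (hF : ContDiffAt ℝ 2 F p) (hhom : ∀ t : ℝ, 0 < t → F (t • p) = F p)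
    {κ : Type*} [Fintype κ] (w : κ → E) (hwV : ∀ j, w j ∈ V)
    (hw : ∀ x ∈ V, ∑ j, inner ℝ (w j) x • w j = x) :
    laplaceBeltrami (subsphere V) g p = ∑ j, fderiv ℝ (fderiv ℝ F) p (w j) (w j) := by
  -- Constancy along the ray gives `hD`, which kills the acceleration term of the great circles, and
  -- `hD2`, which allows `p` to be added to the tangent basis at no cost.
  have hline : (fun t : ℝ => F (p + t • p)) =ᶠ[𝓝 0] fun _ => F p := by
    filter_upwards [lt_mem_nhds (show (-1 : ℝ) < 0 by norm_num)] with t ht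
    rw [← hhom (1 + t) (by linarith), add_smul, one_smul]
  have hD : fderiv ℝ F p p = 0 := by
    have h1 : HasDerivAt (fun t : ℝ => p + t • p) p 0 := by
      simpa using ((hasDerivAt_id (0 : ℝ)).smul_const p).const_add p
    have h2 : HasFDerivAt F (fderiv ℝ F p) (p + (0 : ℝ) • p) := by
      simpa using (hF.differentiableAt (by simp)).hasFDerivAt
    rw [← (h2.comp_hasDerivAt 0 h1).deriv]
    exact hline.deriv_eq.trans (by simp)
  have hD2 : fderiv ℝ (fderiv ℝ F) p p p = 0 := by
    rw [← iteratedDeriv_two_comp_line hF p, hline.iteratedDeriv_eq 2]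
    simp [iteratedDeriv_succ]
  set b := stdOrthonormalBasis ℝ (tangent (subsphere V) p)
  have hb : ∀ i, (b i : E) ∈ V ∧ inner ℝ p (b i : E) = 0 := fun i =>
    (mem_tangent_subsphere hp _).1 (b i).2
  have hterm : ∀ i, iteratedDeriv 2 (fun t => g (geodesic (subsphere V) p (b i : E) t)) 0 =
      fderiv ℝ (fderiv ℝ F) p (b i : E) (b i : E) := by
    intro i
    have : (fun t => g (geodesic (subsphere V) p (b i : E) t)) =
        fun t => F (greatCircle p (b i : E) t) := by
      funext t
      rw [geodesic_subsphere hp (hb i).1 (hb i).2]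
      exact hgF _ (greatCircle_mem hp (hb i).1 (hb i).2 t).2
    rw [this, iteratedDeriv_two_comp_curve (c := greatCircle p (b i : E))
      (by simpa using hF) (Eventually.of_forall fun t => hasDerivAt_greatCircle p (b i : E) t)
      (hasDerivAt_deriv_greatCircle p (b i : E) 0)]
    simp [hD]
  rw [laplaceBeltrami, Finset.sum_congr rfl fun i _ => hterm i]
  have hself : inner ℝ p p = (1 : ℝ) := by
    rw [real_inner_self_eq_norm_sq, hp.2]; norm_num
  -- The tangent basis together with `p` (the value at `none`) is an orthonormal basis of `V`, so
  -- its frame operator is that of `w`.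
  have key := sum_bilin_eq_of_frame (fderiv ℝ (fderiv ℝ F) p)
    (fun o : Option (Fin _) => o.elim p fun i => (b i : E)) w ?_
  · rw [Fintype.sum_option] at key
    simpa [hD2] using key
  intro x
  rw [Fintype.sum_option]
  simp only [Option.elim]
  -- both frame operators are the orthogonal projection to `V`
  obtain ⟨y, hyV, y', hy', rfl⟩ := V.exists_add_mem_mem_orthogonal x
  have hin : ∀ u ∈ V, inner ℝ u (y + y') = inner ℝ u y := fun u hu => by
    rw [inner_add_right, (Submodule.mem_orthogonal V y').1 hy' u hu, add_zero]
  have hb_sum : ∑ i, inner ℝ (b i : E) (y + y') • (b i : E) =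
      ∑ i, inner ℝ (b i : E) y • (b i : E) :=
    Finset.sum_congr rfl fun i _ => by rw [hin _ (hb i).1]
  have hw_sum : ∑ j, inner ℝ (w j) (y + y') • w j = ∑ j, inner ℝ (w j) y • w j :=
    Finset.sum_congr rfl fun j _ => by rw [hin _ (hwV j)]
  rw [hw_sum, hb_sum, hw y hyV, hin p hp.1]
  have hmem : y - inner ℝ p y • p ∈ tangent (subsphere V) p := by
    rw [mem_tangent_subsphere hp]
    refine ⟨V.sub_mem hyV (V.smul_mem _ hp.1), ?_⟩
    rw [inner_sub_right, inner_smul_right, hself, mul_one, sub_self]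
  have h1 := congrArg (Subtype.val) (b.sum_repr' ⟨_, hmem⟩)
  simp only [Submodule.coe_sum, Submodule.coe_smul, Submodule.coe_inner] at h1
  have h2 : ∀ i, inner ℝ (b i : E) (y - inner ℝ p y • p) = inner ℝ (b i : E) y := fun i => by
    rw [inner_sub_right, inner_smul_right, real_inner_comm p (b i : E), (hb i).2, mul_zero,
      sub_zero]
  simp only [h2] at h1
  rw [h1]
  abel

end UnitSphere

/-! ### Octonion algebra. -/

theorem octMul_coord (x y : Oct) :
    (octMul x y = !₂[x 0 * y 0 - x 1 * y 1 - x 2 * y 2 - x 3 * y 3 - x 4 * y 4 - x 5 * y 5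
        - x 6 * y 6 - x 7 * y 7,
      x 0 * y 1 + x 1 * y 0 + x 2 * y 3 - x 3 * y 2 + x 4 * y 5 - x 5 * y 4 - x 6 * y 7
        + x 7 * y 6,
      x 0 * y 2 + x 2 * y 0 + x 3 * y 1 - x 1 * y 3 + x 4 * y 6 - x 6 * y 4 + x 5 * y 7
        - x 7 * y 5,
      x 0 * y 3 + x 3 * y 0 + x 1 * y 2 - x 2 * y 1 + x 4 * y 7 - x 7 * y 4 + x 6 * y 5
        - x 5 * y 6,
      x 0 * y 4 + x 4 * y 0 + x 5 * y 1 - x 1 * y 5 + x 6 * y 2 - x 2 * y 6 + x 7 * y 3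
        - x 3 * y 7,
      x 0 * y 5 + x 5 * y 0 + x 1 * y 4 - x 4 * y 1 + x 7 * y 2 - x 2 * y 7 + x 3 * y 6
        - x 6 * y 3,
      x 0 * y 6 + x 6 * y 0 + x 1 * y 7 - x 7 * y 1 + x 2 * y 4 - x 4 * y 2 + x 5 * y 3
        - x 3 * y 5,
      x 0 * y 7 + x 7 * y 0 + x 6 * y 1 - x 1 * y 6 + x 2 * y 5 - x 5 * y 2 + x 3 * y 4
        - x 4 * y 3]) := by
  ext k
  have h : ∀ k, octMul x y k = ∑ i, ∑ j, (octCoeff i j k : ℝ) * (x i * y j) := fun _ => rfl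
  rw [h]
  fin_cases k <;>
  · simp [Fin.sum_univ_eight, octCoeff, octEps, octTriples]
    ring

theorem oct_norm_sq (x : Oct) : ‖x‖ ^ 2 = x 0 ^ 2 + x 1 ^ 2 + x 2 ^ 2 + x 3 ^ 2 + x 4 ^ 2 + x 5 ^ 2
    + x 6 ^ 2 + x 7 ^ 2 := by
  rw [EuclideanSpace.real_norm_sq_eq, Fin.sum_univ_eight]

/-- The eight square identity. -/
theorem norm_octMul (x y : Oct) : ‖octMul x y‖ = ‖x‖ * ‖y‖ := by
  rw [← sq_eq_sq₀ (norm_nonneg _) (by positivity), mul_pow, octMul_coord, oct_norm_sq,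
    oct_norm_sq x, oct_norm_sq y]
  simp
  ring

theorem octMul_add_left (x y w : Oct) : octMul (x + y) w = octMul x w + octMul y w := by
  ext k
  simp [octMul, add_mul, mul_add, Finset.sum_add_distrib]

theorem octMul_smul_left (a : ℝ) (x w : Oct) : octMul (a • x) w = a • octMul x w := by
  ext k
  simp only [octMul, PiLp.smul_apply, smul_eq_mul, Finset.mul_sum]
  exact Finset.sum_congr rfl fun i _ => Finset.sum_congr rfl fun j _ => by ring

theorem octMul_smul_right (a : ℝ) (x w : Oct) : octMul x (a • w) = a • octMul x w := by
  ext k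
  simp only [octMul, PiLp.smul_apply, smul_eq_mul, Finset.mul_sum]
  exact Finset.sum_congr rfl fun i _ => Finset.sum_congr rfl fun j _ => by ring

/-- This consequence of alternativity replaces associativity: it and the lemma after it are what
make left multiplication by `x ≠ 0` invertible. -/
theorem octMul_conj_octMul (x y : Oct) : octMul (octConj x) (octMul x y) = ‖x‖ ^ 2 • y := by
  rw [octMul_coord, octMul_coord x y, oct_norm_sq]
  ext k
  fin_cases k <;>
  · simp [octConj]
    ring

theorem octMul_octMul_conj (x y : Oct) : octMul x (octMul (octConj x) y) = ‖x‖ ^ 2 • y := by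
  rw [octMul_coord, octMul_coord (octConj x) y, oct_norm_sq]
  ext k
  fin_cases k <;>
  · simp [octConj]
    ring

theorem octInv_mul_cancel_left {x : Oct} (hx : x ≠ 0) (y : Oct) :
    octMul (octInv x) (octMul x y) = y := by
  rw [octInv, octMul_smul_left, octMul_conj_octMul, smul_smul,
    inv_mul_cancel₀ (by simpa using hx), one_smul]

theorem octMul_inv_cancel_left {x : Oct} (hx : x ≠ 0) (y : Oct) :
    octMul x (octMul (octInv x) y) = y := by
  rw [octInv, octMul_smul_left, octMul_smul_right, octMul_octMul_conj, smul_smul,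
    inv_mul_cancel₀ (by simpa using hx), one_smul]

/-- Polarization of `norm_octMul`: right multiplication by `w` scales inner products by `‖w‖ ^ 2`.
-/
theorem inner_octMul_left (x y w : Oct) :
    inner ℝ (octMul x w) (octMul y w) = ‖w‖ ^ 2 * inner ℝ x y := by
  rw [real_inner_eq_norm_add_mul_self_sub_norm_mul_self_sub_norm_mul_self_div_two,
    real_inner_eq_norm_add_mul_self_sub_norm_mul_self_sub_norm_mul_self_div_two,
    ← octMul_add_left, norm_octMul, norm_octMul, norm_octMul]
  ring

theorem continuous_octMul : Continuous fun p : Oct × Oct => octMul p.1 p.2 := by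
  unfold octMul
  fun_prop

theorem continuousAt_octInv {x : Oct} (hx : x ≠ 0) : ContinuousAt octInv x := by
  have h1 : Continuous octConj := by
    unfold octConj
    refine (PiLp.continuous_toLp 2 _).comp (continuous_pi fun k => ?_)
    split_ifs <;> fun_prop
  exact ((continuous_norm.pow 2).continuousAt.inv₀ (by simpa using hx)).smul h1.continuousAt

/-! ### Octonionic lines, Hopf fibers and the sub-Laplacian as a difference of traces. -/

/-- The line `{(y w, y)}` of slope `w` in `𝕆²`. -/
def octLine (w : Oct) : Submodule ℝ Oct2 where
  carrier := {z | z.fst = octMul z.snd w}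
  add_mem' {a b} ha hb := by
    simp only [mem_ofPred_eq] at ha hb ⊢
    rw [WithLp.add_fst, WithLp.add_snd, octMul_add_left, ha, hb]
  zero_mem' := by
    change (0 : Oct) = octMul 0 w
    simpa using (octMul_smul_left 0 0 w).symm
  smul_mem' c a ha := by
    simp only [mem_ofPred_eq] at ha ⊢
    rw [WithLp.smul_fst, WithLp.smul_snd, octMul_smul_left, ha]

theorem mem_octLine {w : Oct} {z : Oct2} : z ∈ octLine w ↔ z.fst = octMul z.snd w := Iff.rfl

theorem sphere_eq_subsphere {E : Type*} [NormedAddCommGroup E] [InnerProductSpace ℝ E] :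
    Metric.sphere (0 : E) 1 = subsphere ⊤ := by
  ext p
  simp [subsphere]

/-- The slope `y⁻¹ x` of `(x, y)`. -/
def slope (z : Oct2) : Oct := octMul (octInv z.snd) z.fst

theorem continuous_fst_oct2 : Continuous fun z : Oct2 => z.fst := by fun_prop

theorem continuous_snd_oct2 : Continuous fun z : Oct2 => z.snd := by fun_prop

theorem continuousAt_slope {z : Oct2} (hz : z.snd ≠ 0) : ContinuousAt slope z := by
  have h0 : ContinuousAt (fun z : Oct2 => octInv z.snd) z :=
    ContinuousAt.comp (f := fun z : Oct2 => z.snd) (continuousAt_octInv hz)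
      continuous_snd_oct2.continuousAt
  exact ContinuousAt.comp (f := fun z : Oct2 => (octInv z.snd, z.fst))
    (g := fun p : Oct × Oct => octMul p.1 p.2) continuous_octMul.continuousAt
    (h0.prodMk continuous_fst_oct2.continuousAt)

theorem fst_eq_octMul_slope {z : Oct2} (hz : z.snd ≠ 0) : z.fst = octMul z.snd (slope z) :=
  (octMul_inv_cancel_left hz _).symm

theorem norm_fst_eq {z : Oct2} (hz : z.snd ≠ 0) : ‖z.fst‖ = ‖z.snd‖ * ‖slope z‖ := by
  rw [← norm_octMul, ← fst_eq_octMul_slope hz]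

/-- The fibers of the Hopf fibration are the unit spheres of octonionic lines. -/
theorem fiber_eq_subsphere {z : Oct2} (hz : z.snd ≠ 0) :
    fiber z = subsphere (octLine (slope z)) := by
  ext z'
  simp only [fiber, S15, sphere_eq_subsphere, subsphere, Submodule.mem_top, true_and,
    mem_ofPred_eq, mem_octLine, and_comm (a := ‖z'‖ = 1)]
  refine and_congr_left fun hn => ?_
  have hz2 : hopf z = ((slope z : Oct) : OnePoint Oct) := by simp [hopf, hz, slope]
  rw [hz2]
  -- A point over `∞` lies in no fiber of finite slope; on the line it would have to be the origin,
  -- which is not a unit vector.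
  by_cases h : z'.snd = 0
  · have h1 : octMul z'.snd (slope z) = 0 := by
      rw [h]; simpa using octMul_smul_left 0 0 (slope z)
    rw [h1]
    refine iff_of_false (by simp [hopf, h]) fun h2 => ?_
    have : z' = 0 := WithLp.ofLp_injective 2 (Prod.ext h2 h)
    simp [this] at hn
  · have h1 : hopf z' = ((slope z' : Oct) : OnePoint Oct) := by simp [hopf, h, slope]
    rw [h1, OnePoint.coe_eq_coe]
    constructor
    · rintro h2
      rw [← h2]
      exact fst_eq_octMul_slope h
    · intro h2
      rw [slope, h2, octInv_mul_cancel_left h]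

/-- The vector of the octonionic line of slope `w` over `y`, normalized to the length of `y`. -/
def lineVec (w y : Oct) : Oct2 := (√(1 + ‖w‖ ^ 2))⁻¹ • WithLp.toLp 2 (octMul y w, y)

theorem continuous_lineVec (y : Oct) : Continuous fun w => lineVec w y := by
  unfold lineVec
  have h1 : Continuous fun w : Oct => (√(1 + ‖w‖ ^ 2))⁻¹ :=
    Continuous.inv₀ (by fun_prop) fun w => by positivity
  have h2 : Continuous fun w : Oct => (octMul y w, y) :=
    (continuous_octMul.comp (continuous_const.prodMk continuous_id)).prodMk continuous_const
  have h3 : Continuous fun w : Oct => (WithLp.toLp 2 (octMul y w, y) : Oct2) := by fun_prop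
  exact h1.smul h3

theorem lineVec_mem (w y : Oct) : lineVec w y ∈ octLine w :=
  (octLine w).smul_mem _ (mem_octLine.2 rfl)

/-- The map `y ↦ (y w, y)` multiplies norms by `√(1 + ‖w‖ ^ 2)`, so after normalization it carries
an orthonormal basis of `𝕆` to one of the line. -/
theorem sum_inner_lineVec {ι : Type*} [Fintype ι] (b : OrthonormalBasis ι ℝ Oct) {w : Oct}
    {z : Oct2} (hz : z ∈ octLine w) :
    ∑ j, inner ℝ (lineVec w (b j)) z • lineVec w (b j) = z := by
  have hpos : (0 : ℝ) < 1 + ‖w‖ ^ 2 := by positivity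
  have h1 : ∀ j, inner ℝ (lineVec w (b j)) z • lineVec w (b j) =
      WithLp.toLp 2 (octMul (inner ℝ (b j) z.snd • b j) w, inner ℝ (b j) z.snd • b j) := by
    intro j
    have h2 : inner ℝ (lineVec w (b j)) z * (√(1 + ‖w‖ ^ 2))⁻¹ = inner ℝ (b j) z.snd := by
      rw [lineVec, inner_smul_left, WithLp.prod_inner_apply]
      change (√(1 + ‖w‖ ^ 2))⁻¹ * (inner ℝ (octMul (b j) w) z.fst + inner ℝ (b j) z.snd) * _ = _
      rw [mem_octLine.1 hz, inner_octMul_left]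
      have := Real.sq_sqrt hpos.le
      have h3 : √(1 + ‖w‖ ^ 2) ≠ 0 := by positivity
      field_simp
      rw [this]
      ring
    rw [lineVec, smul_smul, ← lineVec, h2, octMul_smul_left]
    rfl
  rw [Finset.sum_congr rfl fun j _ => h1 j]
  have hsum : ∑ j, inner ℝ (b j) z.snd • b j = z.snd := b.sum_repr' z.snd
  have hlin : ∀ s : Finset ι, ∑ j ∈ s, (WithLp.toLp 2
      (octMul (inner ℝ (b j) z.snd • b j) w, inner ℝ (b j) z.snd • b j) : Oct2) =
      WithLp.toLp 2 (octMul (∑ j ∈ s, inner ℝ (b j) z.snd • b j) w,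
        ∑ j ∈ s, inner ℝ (b j) z.snd • b j) := by
    classical
    intro s
    induction s using Finset.induction_on with
    | empty =>
      have : octMul 0 w = 0 := by simpa using octMul_smul_left 0 0 w
      simp only [Finset.sum_empty, this]
      rfl
    | insert a s ha ih =>
      rw [Finset.sum_insert ha, Finset.sum_insert ha, ih, octMul_add_left]
      rfl
  rw [hlin, hsum, ← mem_octLine.1 hz]
  rfl

/-- The sub-Laplacian of a function with a `C²` extension `F` that is homogeneous of degree zero. -/
theorem subLaplacian_eq_sum {z : Oct2} (hz : z ∈ S15) (hz2 : z.snd ≠ 0) {g F : Oct2 → ℝ}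
    (hgF : ∀ x, ‖x‖ = 1 → g x = F x) (hF : ContDiffAt ℝ 2 F z)
    (hhom : ∀ t : ℝ, 0 < t → F (t • z) = F z) {ι κ : Type*} [Fintype ι] [Fintype κ]
    (e : OrthonormalBasis κ ℝ Oct2) (b : OrthonormalBasis ι ℝ Oct) :
    subLaplacian g z = ∑ k, fderiv ℝ (fderiv ℝ F) z (e k) (e k) -
      ∑ j, fderiv ℝ (fderiv ℝ F) z (lineVec (slope z) (b j)) (lineVec (slope z) (b j)) := by
  have h15 : z ∈ subsphere (⊤ : Submodule ℝ Oct2) := by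
    rwa [S15, sphere_eq_subsphere] at hz
  rw [subLaplacian, verticalLaplacian, fiber_eq_subsphere hz2, S15, sphere_eq_subsphere,
    laplaceBeltrami_subsphere h15 hgF hF hhom e (fun _ => Submodule.mem_top)
      (fun x _ => e.sum_repr' x),
    laplaceBeltrami_subsphere ⟨fst_eq_octMul_slope hz2, h15.2⟩ hgF hF hhom
      (fun j => lineVec (slope z) (b j)) (fun j => lineVec_mem _ _)
      (fun x hx => sum_inner_lineVec b hx)]

/-! ### Cylindrical coordinates and an explicit formula for `ψ`. -/

section PsiFormula

/-- The radial coordinates `(r, η)` in terms of the coordinates of `𝕆²`. -/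
def radialMap (z : Oct2) : ℝ × ℝ :=
  (Real.arctan (‖z.fst‖ / ‖z.snd‖), Real.arccos (z.snd 0 / ‖z.snd‖))

@[simp] theorem norm_pole : ‖pole‖ = 1 := by simp [pole]

theorem inner_pole (x : Oct) : inner ℝ pole x = x 0 := by
  simp [pole, EuclideanSpace.inner_single_left]

theorem pole_mem : pole ∈ subsphere (⊤ : Submodule ℝ Oct) := ⟨Submodule.mem_top, norm_pole⟩

theorem mem_tangent_S7 (v : Oct) : v ∈ tangent S7 pole ↔ v 0 = 0 := by
  rw [S7, sphere_eq_subsphere, mem_tangent_subsphere pole_mem, inner_pole]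
  simp

theorem expMap_S7 {v : Oct} (hv : v 0 = 0) :
    expMap S7 pole v = Real.cos ‖v‖ • pole + (Real.sin ‖v‖ / ‖v‖) • v := by
  rw [expMap, S7, sphere_eq_subsphere,
    geodesic_subsphere pole_mem Submodule.mem_top (by rwa [inner_pole]), greatCircle, mul_one]

theorem norm_expMap_S7 {v : Oct} (hv : v 0 = 0) : ‖expMap S7 pole v‖ = 1 := by
  rw [expMap, S7, sphere_eq_subsphere,
    geodesic_subsphere pole_mem Submodule.mem_top (by rwa [inner_pole])]
  exact (greatCircle_mem pole_mem Submodule.mem_top (by rwa [inner_pole]) 1).2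

theorem expMap_S7_zero {v : Oct} (hv : v 0 = 0) : expMap S7 pole v 0 = Real.cos ‖v‖ := by
  rw [expMap_S7 hv]
  simp [hv, pole]

/-- The preimage has length `arccos (u 0)` and the direction of the component of `u` orthogonal to
the pole. When that component is zero, `u` is the pole itself, because the antipode is excluded. -/
theorem exists_expMap_S7_eq {u : Oct} (hu : ‖u‖ = 1) (hne : u ≠ -pole) :
    ∃ v : Oct, v 0 = 0 ∧ ‖v‖ < Real.pi ∧ expMap S7 pole v = u := by
  set n := u - u 0 • pole with hn
  have hn0 : n 0 = 0 := by simp [hn, pole]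
  have hun : u = u 0 • pole + n := by simp [hn]
  have hsq : u 0 ^ 2 + ‖n‖ ^ 2 = 1 := by
    have h1 : ‖u‖ ^ 2 = u 0 ^ 2 + ‖n‖ ^ 2 := by
      conv_lhs => rw [hun]
      rw [norm_add_sq_real, inner_smul_left, inner_pole, hn0, norm_smul]
      simp
    rw [← h1, hu]; norm_num
  rcases eq_or_ne n 0 with h0 | h0
  · refine ⟨0, rfl, by simpa using Real.pi_pos, ?_⟩
    rw [expMap_S7 rfl]
    rw [h0, norm_zero] at hsq
    rcases sq_eq_one_iff.1 (by linarith : u 0 ^ 2 = 1) with h | h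
    · rw [hun, h0, h]; simp
    · exact absurd (by rw [hun, h0, h]; simp) hne
  · have hnpos : 0 < ‖n‖ := norm_pos_iff.2 h0
    have hlt : -1 < u 0 := by nlinarith
    have hgt : u 0 < 1 := by nlinarith
    have hpos : 0 < Real.arccos (u 0) := Real.arccos_pos.2 hgt
    have hnorm : ‖(Real.arccos (u 0) / ‖n‖) • n‖ = Real.arccos (u 0) := by
      rw [norm_smul, Real.norm_of_nonneg (by positivity), div_mul_cancel₀ _ hnpos.ne']
    refine ⟨(Real.arccos (u 0) / ‖n‖) • n, by simp [hn0], ?_, ?_⟩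
    · rw [hnorm]
      refine lt_of_le_of_ne (Real.arccos_le_pi _) fun h => ?_
      linarith [Real.arccos_eq_pi.1 h]
    · rw [expMap_S7 (by simp [hn0]), hnorm, Real.cos_arccos hlt.le hgt.le, Real.sin_arccos,
        smul_smul, show 1 - u 0 ^ 2 = ‖n‖ ^ 2 by linarith, Real.sqrt_sq hnpos.le]
      conv_rhs => rw [hun]
      congr 1
      rw [div_mul_div_cancel₀ hpos.ne', div_self hnpos.ne', one_smul]

variable (Y : OrthonormalBasis (Fin 7) ℝ (tangent S7 pole))

theorem sum_smul_tangent (θ : EuclideanSpace ℝ (Fin 7)) :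
    (∑ i, θ i • (Y i : Oct)) = (Y.repr.symm θ : Oct) := by
  rw [← Y.sum_repr (Y.repr.symm θ)]
  simp

theorem radialMap_cylPoint {c : Oct × EuclideanSpace ℝ (Fin 7)} (hc : c ∈ cylDomain) :
    radialMap (cylPoint Y c) = (Real.arctan ‖c.1‖, ‖c.2‖) := by
  have hv : (Y.repr.symm c.2 : Oct) 0 = 0 := (mem_tangent_S7 _).1 (Y.repr.symm c.2).2
  have hnorm : ‖(Y.repr.symm c.2 : Oct)‖ = ‖c.2‖ := Y.repr.symm.norm_map c.2
  set k := (√(1 + ‖c.1‖ ^ 2))⁻¹ with hk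
  have hkpos : 0 < k := by positivity
  set u := expMap S7 pole (Y.repr.symm c.2 : Oct) with hu
  have hfst : (cylPoint Y c).fst = k • octMul u c.1 := by
    simp only [cylPoint, sum_smul_tangent, ← hu, ← hk]; rfl
  have hsnd : (cylPoint Y c).snd = k • u := by
    simp only [cylPoint, sum_smul_tangent, ← hu, ← hk]; rfl
  have hun : ‖u‖ = 1 := norm_expMap_S7 hv
  rw [radialMap, hfst, hsnd, norm_smul, norm_smul, norm_octMul, hun, PiLp.smul_apply, hu,
    expMap_S7_zero hv, hnorm, Real.norm_of_nonneg hkpos.le, smul_eq_mul, one_mul, mul_one,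
    mul_div_cancel_left₀ _ hkpos.ne', mul_div_cancel_left₀ _ hkpos.ne',
    Real.arccos_cos (norm_nonneg _) (le_of_lt hc)]

theorem norm_sq_oct2 (z : Oct2) : ‖z‖ ^ 2 = ‖z.fst‖ ^ 2 + ‖z.snd‖ ^ 2 :=
  WithLp.prod_norm_sq_eq_of_L2 z

/-- The length of the second component in terms of the slope. -/
theorem inv_sqrt_slope {z : Oct2} (hz : z ∈ S15) (hz2 : z.snd ≠ 0) :
    (√(1 + ‖slope z‖ ^ 2))⁻¹ = ‖z.snd‖ := by
  have hpos : 0 < ‖z.snd‖ := norm_pos_iff.2 hz2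
  have h1 : ‖z‖ = 1 := by simpa [S15] using hz
  have h2 := norm_sq_oct2 z
  rw [h1, norm_fst_eq hz2] at h2
  have h3 : 1 + ‖slope z‖ ^ 2 = (‖z.snd‖⁻¹) ^ 2 := by
    field_simp
    linarith
  rw [h3, Real.sqrt_sq (by positivity), inv_inv]

theorem exists_cylPoint_eq {z : Oct2} (hz : z ∈ Omega) : ∃ c ∈ cylDomain, cylPoint Y c = z := by
  obtain ⟨h15, h2, hne⟩ := hz
  have hpos : 0 < ‖z.snd‖ := norm_pos_iff.2 h2
  obtain ⟨v, hv0, hvpi, hvu⟩ := exists_expMap_S7_eq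
    (by rw [norm_smul, norm_inv, norm_norm, inv_mul_cancel₀ hpos.ne'] :
      ‖‖z.snd‖⁻¹ • z.snd‖ = 1) hne
  refine ⟨(slope z, Y.repr ⟨v, (mem_tangent_S7 v).2 hv0⟩), ?_, ?_⟩
  · change ‖Y.repr _‖ < Real.pi
    rw [Y.repr.norm_map]
    exact hvpi
  · simp only [cylPoint, sum_smul_tangent, LinearIsometryEquiv.symm_apply_apply, hvu]
    rw [inv_sqrt_slope h15 h2]
    refine WithLp.ofLp_injective 2 (Prod.ext ?_ ?_)
    · change ‖z.snd‖ • octMul (‖z.snd‖⁻¹ • z.snd) (slope z) = z.fst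
      rw [octMul_smul_left, smul_smul, mul_inv_cancel₀ hpos.ne', one_smul,
        ← fst_eq_octMul_slope h2]
    · change ‖z.snd‖ • ‖z.snd‖⁻¹ • z.snd = z.snd
      rw [smul_smul, mul_inv_cancel₀ hpos.ne', one_smul]

/-- Injectivity of the coordinates is not needed: whichever preimage `invFunOn` selects,
`radialMap_cylPoint` recovers its radial coordinates from the point. -/
theorem psi_eq_radialMap {z : Oct2} (hz : z ∈ Omega) : psi Y z = radialMap z := by
  have h : ∃ c ∈ cylDomain, cylPoint Y c = z := exists_cylPoint_eq Y hz
  rw [psi, ← radialMap_cylPoint Y (Function.invFunOn_mem h), Function.invFunOn_eq h]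

/-- The cone over `Omega`. -/
def omegaCone : Set Oct2 := {z | z.snd ≠ 0 ∧ ‖z.snd‖⁻¹ • z.snd ≠ -pole}

theorem isOpen_omegaCone : IsOpen omegaCone := by
  have h0 : IsOpen {z : Oct2 | z.snd ≠ 0} := isOpen_ne.preimage continuous_snd_oct2
  rw [isOpen_iff_mem_nhds]
  rintro z ⟨h1, h2⟩
  have hc : ContinuousAt (fun z : Oct2 => ‖z.snd‖⁻¹ • z.snd) z :=
    (continuous_snd_oct2.norm.continuousAt.inv₀ (by simpa using h1)).smul
      continuous_snd_oct2.continuousAt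
  filter_upwards [h0.mem_nhds h1, hc.eventually_ne h2] with x hx1 hx2 using ⟨hx1, hx2⟩

theorem smul_mem_omegaCone {z : Oct2} (hz : z ∈ omegaCone) {t : ℝ} (ht : 0 < t) :
    t • z ∈ omegaCone := by
  refine ⟨?_, ?_⟩
  · rw [WithLp.smul_snd]
    exact smul_ne_zero ht.ne' hz.1
  · rw [WithLp.smul_snd, norm_smul, Real.norm_of_nonneg ht.le, smul_smul]
    rw [show (t * ‖z.snd‖)⁻¹ * t = ‖z.snd‖⁻¹ by field_simp]
    exact hz.2

theorem normalize_mem_Omega {z : Oct2} (hz : z ∈ omegaCone) : ‖z‖⁻¹ • z ∈ Omega := by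
  have h0 : z ≠ 0 := by
    rintro rfl
    exact hz.1 rfl
  have hpos : 0 < ‖z‖ := norm_pos_iff.2 h0
  have h1 := smul_mem_omegaCone hz (inv_pos.2 hpos)
  refine ⟨?_, h1.1, h1.2⟩
  simp [S15, norm_smul, hpos.ne']

theorem radialMap_smul (z : Oct2) {t : ℝ} (ht : 0 < t) : radialMap (t • z) = radialMap z := by
  simp only [radialMap, WithLp.smul_fst, WithLp.smul_snd, norm_smul, Real.norm_of_nonneg ht.le,
    PiLp.smul_apply, smul_eq_mul, mul_div_mul_left _ _ ht.ne']

theorem psi_normalize {z : Oct2} (hz : z ∈ omegaCone) : psi Y (‖z‖⁻¹ • z) = radialMap z := by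
  have h0 : z ≠ 0 := by
    rintro rfl
    exact hz.1 rfl
  rw [psi_eq_radialMap Y (normalize_mem_Omega hz),
    radialMap_smul z (inv_pos.2 (norm_pos_iff.2 h0))]

end PsiFormula

/-! ### Two-jets of the radial coordinates along lines, and `radialOp` in terms of Fréchet
derivatives. -/

/-- `ρ` is twice differentiable at `0`, with first and second derivatives `a` and `b`. -/
def HasTwoJet (ρ : ℝ → ℝ) (a b : ℝ) : Prop :=
  ∃ ρ₁ : ℝ → ℝ, (∀ᶠ t in 𝓝 0, HasDerivAt ρ (ρ₁ t) t) ∧ ρ₁ 0 = a ∧ HasDerivAt ρ₁ b 0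

theorem hasTwoJet_const (x : ℝ) : HasTwoJet (fun _ => x) 0 0 :=
  ⟨fun _ => 0, Eventually.of_forall fun t => hasDerivAt_const t x, rfl, hasDerivAt_const _ _⟩

theorem HasTwoJet.const_add {ρ : ℝ → ℝ} {a b : ℝ} (h : HasTwoJet ρ a b) (x : ℝ) :
    HasTwoJet (fun t => x + ρ t) a b := by
  obtain ⟨ρ₁, h1, h2, h3⟩ := h
  exact ⟨ρ₁, h1.mono fun t ht => ht.const_add x, h2, h3⟩

theorem HasTwoJet.const_sub {ρ : ℝ → ℝ} {a b : ℝ} (h : HasTwoJet ρ a b) (x : ℝ) :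
    HasTwoJet (fun t => x - ρ t) (-a) (-b) := by
  obtain ⟨ρ₁, h1, h2, h3⟩ := h
  exact ⟨fun t => -ρ₁ t, h1.mono fun t ht => ht.const_sub x, congrArg Neg.neg h2, h3.neg⟩

theorem hasTwoJet_arctan (α β : ℝ) : HasTwoJet (fun t => Real.arctan (α + t * β))
    (β / (1 + α ^ 2)) (-(2 * α * β ^ 2) / (1 + α ^ 2) ^ 2) := by
  have hl : ∀ t : ℝ, HasDerivAt (fun t : ℝ => α + t * β) β t := fun t => by
    simpa using ((hasDerivAt_id t).mul_const β).const_add α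
  refine ⟨fun t => 1 / (1 + (α + t * β) ^ 2) * β,
    Eventually.of_forall fun t => (hl t).arctan, by simp; ring, ?_⟩
  have h1 : HasDerivAt (fun t : ℝ => 1 + (α + t * β) ^ 2) _ 0 := ((hl 0).pow 2).const_add 1
  have hne : 1 + (α + 0 * β) ^ 2 ≠ 0 := by positivity
  refine (((hasDerivAt_const (0 : ℝ) (1 : ℝ)).div h1 hne).mul_const β).congr_deriv ?_
  simp
  ring

/-- Along directions orthogonal to the base vector, norms depend on `t` only through `t ^ 2`, so the
first derivative vanishes and the second needs only `h'`. -/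
theorem hasTwoJet_comp_sq {h : ℝ → ℝ} {a h' : ℝ} (k : ℝ) (hh : ContDiffAt ℝ 2 h a)
    (hd : HasDerivAt h h' a) : HasTwoJet (fun t => h (a + k * t ^ 2)) 0 (2 * k * h') := by
  have hl : ∀ t : ℝ, HasDerivAt (fun t : ℝ => a + k * t ^ 2) (k * (2 * t)) t := fun t => by
    simpa using (((hasDerivAt_id t).pow 2).const_mul k).const_add a
  have hl0 : Tendsto (fun t : ℝ => a + k * t ^ 2) (𝓝 0) (𝓝 a) := by
    have := (hl 0).continuousAt.tendsto
    simpa using this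
  refine ⟨fun t => deriv h (a + k * t ^ 2) * (k * (2 * t)), ?_, by simp, ?_⟩
  · have h1 : ∀ᶠ x in 𝓝 a, HasDerivAt h (deriv h x) x := by
      filter_upwards [hh.eventually (by simp)] with x hx
      exact (hx.differentiableAt (by simp)).hasDerivAt
    filter_upwards [hl0.eventually h1] with t ht
    exact ht.comp t (hl t)
  · have h2 : DifferentiableAt ℝ (deriv h) (a + k * 0 ^ 2) := by
      have : ContDiffAt ℝ 1 (deriv h) a := ContDiffAt.derivWithin hh (by norm_num)
      simpa using this.differentiableAt (by simp)
    have h3 : HasDerivAt (fun t : ℝ => k * (2 * t)) (k * (2 * 1)) 0 :=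
      ((hasDerivAt_id (0 : ℝ)).const_mul 2).const_mul k
    refine ((h2.hasDerivAt.comp 0 (hl 0)).mul h3).congr_deriv ?_
    simp [hd.deriv]
    ring

theorem iteratedDeriv_two_comp_pair {f : ℝ × ℝ → ℝ} {ρ η : ℝ → ℝ} {a b a' b' : ℝ}
    (hf : ContDiffAt ℝ 2 f (ρ 0, η 0)) (hρ : HasTwoJet ρ a b) (hη : HasTwoJet η a' b') :
    iteratedDeriv 2 (fun t => f (ρ t, η t)) 0 =
      fderiv ℝ (fderiv ℝ f) (ρ 0, η 0) (a, a') (a, a') + fderiv ℝ f (ρ 0, η 0) (b, b') := by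
  obtain ⟨ρ₁, h1, h2, h3⟩ := hρ
  obtain ⟨η₁, g1, g2, g3⟩ := hη
  have := iteratedDeriv_two_comp_curve (F := f) (c := fun t => (ρ t, η t))
    (c₁ := fun t => (ρ₁ t, η₁ t)) (c₂ := (b, b')) (t₀ := 0) hf
    (by filter_upwards [h1, g1] with t ht gt using ht.prodMk gt) (h3.prodMk g3)
  rw [this, h2, g2]

/-- The radial operator in terms of the derivatives of `f`. -/
theorem radialOp_eq {f : ℝ × ℝ → ℝ} {q : ℝ × ℝ} (hf : ContDiffAt ℝ 2 f q) :
    radialOp f q = fderiv ℝ (fderiv ℝ f) q (1, 0) (1, 0)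
      + (7 * Real.cot q.1 - 7 * Real.tan q.1) * fderiv ℝ f q (1, 0)
      + Real.tan q.1 ^ 2 * (fderiv ℝ (fderiv ℝ f) q (0, 1) (0, 1)
        + 6 * Real.cot q.2 * fderiv ℝ f q (0, 1)) := by
  have hd : HasFDerivAt f (fderiv ℝ f q) q := (hf.differentiableAt (by simp)).hasFDerivAt
  have e1 : iteratedDeriv 2 (fun r => f (r, q.2)) q.1 =
      fderiv ℝ (fderiv ℝ f) q (1, 0) (1, 0) := by
    have := iteratedDeriv_two_comp_curve (F := f) (c := fun r => (r, q.2))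
      (c₁ := fun _ => (1, 0)) (c₂ := 0) (t₀ := q.1) hf
      (Eventually.of_forall fun t => (hasDerivAt_id t).prodMk (hasDerivAt_const t q.2))
      (hasDerivAt_const _ _)
    simpa using this
  have e2 : iteratedDeriv 2 (fun η => f (q.1, η)) q.2 =
      fderiv ℝ (fderiv ℝ f) q (0, 1) (0, 1) := by
    have := iteratedDeriv_two_comp_curve (F := f) (c := fun η => (q.1, η))
      (c₁ := fun _ => (0, 1)) (c₂ := 0) (t₀ := q.2) hf
      (Eventually.of_forall fun t => (hasDerivAt_const t q.1).prodMk (hasDerivAt_id t))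
      (hasDerivAt_const _ _)
    simpa using this
  have e3 : deriv (fun r => f (r, q.2)) q.1 = fderiv ℝ f q (1, 0) :=
    (HasFDerivAt.comp_hasDerivAt (f := fun r => (r, q.2)) q.1 hd
      ((hasDerivAt_id q.1).prodMk (hasDerivAt_const q.1 q.2))).deriv
  have e4 : deriv (fun η => f (q.1, η)) q.2 = fderiv ℝ f q (0, 1) :=
    (HasFDerivAt.comp_hasDerivAt (f := fun η => (q.1, η)) q.2 hd
      ((hasDerivAt_const q.2 q.1).prodMk (hasDerivAt_id q.2))).deriv
  rw [radialOp, e1, e2, e3, e4]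

section Jets

variable {s c : ℝ}

theorem hasTwoJet_arctan_add_div (hc : 0 < c) (hsc : s ^ 2 + c ^ 2 = 1) :
    HasTwoJet (fun t => Real.arctan ((s + t) / c)) c (-(2 * s * c)) := by
  have h := hasTwoJet_arctan (s / c) (1 / c)
  have h1 : 1 + (s / c) ^ 2 = 1 / c ^ 2 := by
    field_simp
    linarith
  rw [h1] at h
  convert h using 1
  · funext t; ring_nf
  · field_simp
  · field_simp

theorem hasTwoJet_arctan_div_add (hs : 0 < s) (hc : 0 < c) (hsc : s ^ 2 + c ^ 2 = 1) :
    HasTwoJet (fun t => Real.arctan (s / (c + t))) (-s) (2 * s * c) := by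
  -- Exchanging `s` and `c` reflects the angle to `π/2` minus itself, which reduces this case to
  -- `hasTwoJet_arctan_add_div`.
  obtain ⟨ρ₁, h1, h2, h3⟩ :=
    (hasTwoJet_arctan_add_div hs (by linarith : c ^ 2 + s ^ 2 = 1)).const_sub (Real.pi / 2)
  refine ⟨ρ₁, ?_, h2, h3.congr_deriv (by ring)⟩
  have hev : ∀ᶠ t in 𝓝 (0 : ℝ), ∀ᶠ u in 𝓝 t, 0 < c + u := by
    refine eventually_eventually_nhds.2 ?_
    filter_upwards [lt_mem_nhds (neg_lt_zero.2 hc)] with t ht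
    linarith
  filter_upwards [h1, hev] with t ht hu
  refine ht.congr_of_eventuallyEq ?_
  filter_upwards [hu] with u hu
  rw [← Real.arctan_inv_of_pos (by positivity), inv_div]

theorem hasTwoJet_arctan_sqrt_div (hs : 0 < s) (hc : 0 < c) (hsc : s ^ 2 + c ^ 2 = 1) :
    HasTwoJet (fun t => Real.arctan (√(s ^ 2 + 1 * t ^ 2) / c)) 0 (c / s) := by
  have hne : s ^ 2 ≠ 0 := by positivity
  have h1 : ContDiffAt ℝ 2 (fun u => Real.arctan (√u / c)) (s ^ 2) :=
    ((Real.contDiffAt_sqrt hne).div_const c).arctan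
  have h2 : HasDerivAt (fun u => Real.arctan (√u / c)) (c / (2 * s)) (s ^ 2) := by
    refine (((Real.hasDerivAt_sqrt hne).div_const c).arctan).congr_deriv ?_
    rw [Real.sqrt_sq hs.le, show 1 + (s / c) ^ 2 = 1 / c ^ 2 by field_simp; linarith]
    field_simp
  convert hasTwoJet_comp_sq 1 h1 h2 using 1
  field_simp

theorem hasDerivAt_inv_sqrt (hc : 0 < c) (a : ℝ) :
    HasDerivAt (fun u => a / √u) (-(a / (2 * c ^ 3))) (c ^ 2) := by
  have hne : c ^ 2 ≠ 0 := by positivity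
  refine ((hasDerivAt_const _ a).div (Real.hasDerivAt_sqrt hne)
    (by positivity)).congr_deriv ?_
  rw [Real.sqrt_sq hc.le]
  field_simp
  ring

theorem contDiffAt_inv_sqrt (hc : 0 < c) (a : ℝ) :
    ContDiffAt ℝ 2 (fun u => a / √u) (c ^ 2) :=
  contDiffAt_const.div (Real.contDiffAt_sqrt (by positivity)) (by positivity)

theorem hasTwoJet_arctan_div_sqrt (hc : 0 < c) (hsc : s ^ 2 + c ^ 2 = 1) :
    HasTwoJet (fun t => Real.arctan (s / √(c ^ 2 + 1 * t ^ 2))) 0 (-(s / c)) := by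
  have h2 : HasDerivAt (fun u => Real.arctan (s / √u)) (-(s / (2 * c))) (c ^ 2) := by
    refine ((hasDerivAt_inv_sqrt hc s).arctan).congr_deriv ?_
    rw [Real.sqrt_sq hc.le, show 1 + (s / c) ^ 2 = 1 / c ^ 2 by field_simp; linarith]
    field_simp
  convert hasTwoJet_comp_sq 1 (contDiffAt_inv_sqrt hc s).arctan h2 using 1
  field_simp

theorem hasTwoJet_arccos_div_sqrt (hc : 0 < c) {C : ℝ} (h1 : -1 < C) (h2 : C < 1) (k : ℝ) :
    HasTwoJet (fun t => Real.arccos (c * C / √(c ^ 2 + k * t ^ 2))) 0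
      (k * (C / (c ^ 2 * √(1 - C ^ 2)))) := by
  have he : c * C / √(c ^ 2) = C := by
    rw [Real.sqrt_sq hc.le]; field_simp
  have hS : 0 < √(1 - C ^ 2) := Real.sqrt_pos.2 (by nlinarith)
  have h3 : HasDerivAt (fun u => Real.arccos (c * C / √u))
      (C / (2 * (c ^ 2 * √(1 - C ^ 2)))) (c ^ 2) := by
    have := Real.hasDerivAt_arccos (x := c * C / √(c ^ 2)) (by rw [he]; exact h1.ne')
      (by rw [he]; exact h2.ne)
    refine (this.comp (c ^ 2) (hasDerivAt_inv_sqrt hc (c * C))).congr_deriv ?_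
    rw [he]
    field_simp
  have h4 : ContDiffAt ℝ 2 (fun u => Real.arccos (c * C / √u)) (c ^ 2) :=
    ContDiffAt.comp (f := fun u => c * C / √u) (c ^ 2)
      (Real.contDiffAt_arccos (by rw [he]; exact h1.ne') (by rw [he]; exact h2.ne))
      (contDiffAt_inv_sqrt hc (c * C))
  convert hasTwoJet_comp_sq k h4 h3 using 1
  field_simp

theorem hasTwoJet_add_arctan (θ β : ℝ) :
    HasTwoJet (fun t => θ + Real.arctan (t * β)) β 0 := by
  simpa using (hasTwoJet_arctan 0 β).const_add θ

/-- In the plane spanned by the pole and `y`, moving a distance `t` perpendicular to `y`, away from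
the pole, turns `y` by the angle `arctan (t / c)`. -/
theorem eventually_arccos_rotate (hc : 0 < c) {C : ℝ} (h1 : -1 < C) (h2 : C < 1) :
    ∀ᶠ t in 𝓝 (0 : ℝ), Real.arccos ((c * C + t * -√(1 - C ^ 2)) / √(c ^ 2 + t ^ 2)) =
      Real.arccos C + Real.arctan (t / c) := by
  have hcont : Tendsto (fun t => Real.arccos C + Real.arctan (t / c)) (𝓝 0)
      (𝓝 (Real.arccos C)) := by
    have : ContinuousAt (fun t => Real.arccos C + Real.arctan (t / c)) 0 := by fun_prop
    simpa [ContinuousAt] using this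
  have hpi : Real.arccos C < Real.pi :=
    lt_of_le_of_ne (Real.arccos_le_pi _) fun h => by linarith [Real.arccos_eq_pi.1 h]
  filter_upwards [hcont.eventually (lt_mem_nhds (Real.arccos_pos.2 h2)),
    hcont.eventually (gt_mem_nhds hpi)] with t ht1 ht2
  rw [← Real.arccos_cos ht1.le ht2.le]
  congr 1
  rw [Real.cos_add, Real.cos_arccos h1.le h2.le, Real.sin_arccos, Real.cos_arctan,
    Real.sin_arctan]
  have hsq : √(c ^ 2 + t ^ 2) = c * √(1 + (t / c) ^ 2) := by
    rw [← Real.sqrt_sq hc.le, ← Real.sqrt_mul (by positivity), Real.sqrt_sq hc.le]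
    congr 1
    field_simp
  rw [hsq]
  have : 0 < √(1 + (t / c) ^ 2) := by positivity
  field_simp
  ring

end Jets

/-! ### Norms along lines and adapted orthonormal bases. -/

section Lines

variable {E : Type*} [NormedAddCommGroup E] [InnerProductSpace ℝ E]

theorem norm_add_smul_of_inner_eq_zero {x b : E} (hb : ‖b‖ = 1) (h : inner ℝ x b = 0) (t : ℝ) :
    ‖x + t • b‖ = √(‖x‖ ^ 2 + t ^ 2) := by
  rw [eq_comm, Real.sqrt_eq_iff_eq_sq (by positivity) (norm_nonneg _), norm_add_sq_real,
    inner_smul_right, h, norm_smul, hb, Real.norm_eq_abs, mul_one, sq_abs]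
  ring

theorem norm_add_smul_normalized {x : E} (hx : x ≠ 0) {t : ℝ} (ht : -‖x‖ < t) :
    ‖x + t • ‖x‖⁻¹ • x‖ = ‖x‖ + t := by
  have hpos : 0 < ‖x‖ := norm_pos_iff.2 hx
  have : x + t • ‖x‖⁻¹ • x = ((‖x‖ + t) * ‖x‖⁻¹) • x := by
    rw [add_mul, mul_inv_cancel₀ hpos.ne', add_smul, one_smul, smul_smul]
  rw [this, norm_smul, norm_mul, norm_inv, norm_norm, Real.norm_of_nonneg (by linarith),
    mul_assoc, inv_mul_cancel₀ hpos.ne', mul_one]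

theorem exists_orthonormalBasis_zero {n : ℕ} (hn : Module.finrank ℝ E = n + 1) {u : E}
    (hu : ‖u‖ = 1) : ∃ b : OrthonormalBasis (Fin (n + 1)) ℝ E, b 0 = u := by
  have : FiniteDimensional ℝ E := Module.finite_of_finrank_eq_succ hn
  obtain ⟨b, hb⟩ := Orthonormal.exists_orthonormalBasis_extension_of_card_eq (𝕜 := ℝ)
    (ι := Fin (n + 1)) (by simpa using hn) (v := fun _ => u) (s := {0})
    ⟨fun i => hu, fun i j hij => absurd (Subsingleton.elim i j) hij⟩
  exact ⟨b, hb 0 rfl⟩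

theorem exists_orthonormalBasis_zero_one {n : ℕ} (hn : Module.finrank ℝ E = n + 2) {u v : E}
    (hu : ‖u‖ = 1) (hv : ‖v‖ = 1) (huv : inner ℝ u v = 0) :
    ∃ b : OrthonormalBasis (Fin (n + 2)) ℝ E, b 0 = u ∧ b 1 = v := by
  have : FiniteDimensional ℝ E := Module.finite_of_finrank_eq_succ hn
  obtain ⟨b, hb⟩ := Orthonormal.exists_orthonormalBasis_extension_of_card_eq (𝕜 := ℝ)
    (ι := Fin (n + 2)) (by simpa using hn) (v := fun i => if i = 0 then u else v) (s := {0, 1})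
    (by
      refine ⟨?_, ?_⟩
      · rintro ⟨i, rfl | rfl⟩ <;> simp [hu, hv]
      · rintro ⟨i, rfl | rfl⟩ ⟨j, rfl | rfl⟩ hij
        · exact absurd rfl hij
        · simpa using huv
        · simpa [real_inner_comm] using huv
        · exact absurd rfl hij)
  exact ⟨b, by simpa using hb 0 (by simp), by simpa using hb 1 (by simp)⟩

end Lines

/-! ### The sub-Laplacian at a point with `r > 0` and `η > 0`. -/

theorem contDiffAt_radialMap {z : Oct2} (h1 : z.fst ≠ 0) (h2 : z.snd ≠ 0)
    (h3 : -1 < z.snd 0 / ‖z.snd‖) (h4 : z.snd 0 / ‖z.snd‖ < 1) : ContDiffAt ℝ 2 radialMap z := by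
  have hf : ContDiff ℝ 2 fun z : Oct2 => z.fst := (WithLp.fstL 2 ℝ Oct Oct).contDiff
  have hs : ContDiff ℝ 2 fun z : Oct2 => z.snd := (WithLp.sndL 2 ℝ Oct Oct).contDiff
  have hs0 : ContDiff ℝ 2 fun z : Oct2 => z.snd 0 :=
    (EuclideanSpace.proj (𝕜 := ℝ) (0 : Fin 8)).contDiff.comp hs
  have hnf : ContDiffAt ℝ 2 (fun z : Oct2 => ‖z.fst‖) z := hf.contDiffAt.norm ℝ h1
  have hns : ContDiffAt ℝ 2 (fun z : Oct2 => ‖z.snd‖) z := hs.contDiffAt.norm ℝ h2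
  have hne : ‖z.snd‖ ≠ 0 := norm_ne_zero_iff.2 h2
  exact (hnf.div hns hne).arctan.prodMk
    (ContDiffAt.comp (f := fun z : Oct2 => z.snd 0 / ‖z.snd‖) z
      (Real.contDiffAt_arccos h3.ne' h4.ne) (hs0.contDiffAt.div hns hne))

theorem hess_line_of_radialMap {z v : Oct2} {F : Oct2 → ℝ} {f : ℝ × ℝ → ℝ} {ρ η : ℝ → ℝ}
    {a b a' b' : ℝ} (hF : ContDiffAt ℝ 2 F z) (hFf : F =ᶠ[𝓝 z] f ∘ radialMap)
    (hf : ContDiffAt ℝ 2 f (radialMap z)) (hρ : HasTwoJet ρ a b) (hη : HasTwoJet η a' b')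
    (h : ∀ᶠ t : ℝ in 𝓝 0, radialMap (z + t • v) = (ρ t, η t)) :
    fderiv ℝ (fderiv ℝ F) z v v =
      fderiv ℝ (fderiv ℝ f) (radialMap z) (a, a') (a, a') +
        fderiv ℝ f (radialMap z) (b, b') := by
  have h0 : radialMap z = (ρ 0, η 0) := by simpa using h.self_of_nhds
  have hl : Tendsto (fun t : ℝ => z + t • v) (𝓝 0) (𝓝 z) := by
    have : ContinuousAt (fun t : ℝ => z + t • v) 0 := by fun_prop
    simpa [ContinuousAt] using this
  have he : (fun t : ℝ => F (z + t • v)) =ᶠ[𝓝 0] fun t => f (ρ t, η t) := by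
    filter_upwards [hl.eventually hFf, h] with t ht1 ht2
    rw [ht1, Function.comp_apply, ht2]
  rw [← iteratedDeriv_two_comp_line hF, he.iteratedDeriv_eq, h0,
    iteratedDeriv_two_comp_pair (by rwa [← h0]) hρ hη]

/-- The sub-Laplacian of a function of the radial coordinates. -/
theorem subLaplacian_radial {z : Oct2} (hz : z ∈ S15) (hq : radialMap z ∈ radialInterior)
    {f : ℝ × ℝ → ℝ} (hf : ContDiffAt ℝ 2 f (radialMap z)) {g F : Oct2 → ℝ}
    (hgF : ∀ x, ‖x‖ = 1 → g x = F x) (hhom : ∀ t : ℝ, 0 < t → F (t • z) = F z)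
    (hFf : F =ᶠ[𝓝 z] f ∘ radialMap) :
    subLaplacian g z = radialOp f (radialMap z) := by
  obtain ⟨⟨hr1, hr2⟩, hη1, hη2⟩ := hq
  have hη1' : 0 < Real.arccos (z.snd 0 / ‖z.snd‖) := hη1
  have hη2' : Real.arccos (z.snd 0 / ‖z.snd‖) < Real.pi := hη2
  have hrpos : 0 < ‖z.fst‖ / ‖z.snd‖ := Real.arctan_pos.1 hr1
  have hx : z.fst ≠ 0 := by
    intro h; simp [h] at hrpos
  have hy : z.snd ≠ 0 := by
    intro h; simp [h] at hrpos
  have hs : 0 < ‖z.fst‖ := norm_pos_iff.2 hx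
  have hc : 0 < ‖z.snd‖ := norm_pos_iff.2 hy
  have hsc : ‖z.fst‖ ^ 2 + ‖z.snd‖ ^ 2 = 1 := by
    rw [← norm_sq_oct2, show ‖z‖ = 1 by simpa [S15] using hz]; norm_num
  have hC2 : z.snd 0 / ‖z.snd‖ < 1 := Real.arccos_pos.1 hη1'
  have hC1 : -1 < z.snd 0 / ‖z.snd‖ := by
    by_contra! h
    exact hη2'.ne (Real.arccos_of_le_neg_one h)
  have hF : ContDiffAt ℝ 2 F z :=
    ContDiffAt.congr_of_eventuallyEq (hf.comp z (contDiffAt_radialMap hx hy hC1 hC2)) hFf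
  have hy0 : z.snd 0 = ‖z.snd‖ * (z.snd 0 / ‖z.snd‖) := by field_simp
  have hrad : radialMap z =
    (Real.arctan (‖z.fst‖ / ‖z.snd‖), Real.arccos (z.snd 0 / ‖z.snd‖)) := rfl
  have hslope : ‖slope z‖ = ‖z.fst‖ / ‖z.snd‖ := by
    rw [norm_fst_eq hy]; field_simp
  have hk := inv_sqrt_slope hz hy
  set s := ‖z.fst‖ with hs_def
  set c := ‖z.snd‖ with hc_def
  set C := z.snd 0 / c with hC_def
  set S := √(1 - C ^ 2) with hS_def
  have hS : 0 < S := Real.sqrt_pos.2 (by nlinarith)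
  have hSsq : S ^ 2 = 1 - C ^ 2 := Real.sq_sqrt (by nlinarith)
  -- orthonormal bases adapted to the point
  set u : Oct := c⁻¹ • z.snd with hu_def
  have hun : ‖u‖ = 1 := by
    rw [hu_def, norm_smul, norm_inv, hc_def, norm_norm, inv_mul_cancel₀ hc.ne']
  have hu0 : u 0 = C := by
    rw [hu_def, PiLp.smul_apply, smul_eq_mul, hC_def]; ring
  have hyu : z.snd = c • u := by rw [hu_def, smul_smul, mul_inv_cancel₀ hc.ne', one_smul]
  -- The unit vector orthogonal to `u` in the plane of `u` and the pole, pointing in the direction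
  -- of increasing `η`.
  set n : Oct := S⁻¹ • (C • u - pole) with hn_def
  have hup : inner ℝ u pole = C := by rw [real_inner_comm, inner_pole, hu0]
  have hnn : ‖n‖ = 1 := by
    rw [← sq_eq_sq₀ (norm_nonneg _) zero_le_one, hn_def, norm_smul, mul_pow, norm_sub_sq_real,
      inner_smul_left, hup, norm_smul, hun, norm_pole, norm_inv, Real.norm_of_nonneg hS.le,
      Real.norm_eq_abs, mul_one, sq_abs]
    simp only [conj_trivial]
    field_simp
    linarith
  have hunn : inner ℝ u n = 0 := by
    rw [hn_def, inner_smul_right, inner_sub_right, inner_smul_right, hup,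
      real_inner_self_eq_norm_sq, hun]
    ring
  have hn0 : n 0 = -S := by
    rw [hn_def, PiLp.smul_apply, PiLp.sub_apply, PiLp.smul_apply, hu0, ← inner_pole pole,
      real_inner_self_eq_norm_sq, norm_pole]
    simp only [smul_eq_mul]
    field_simp
    linarith
  have hdim : Module.finrank ℝ Oct = 8 := by simp
  obtain ⟨bx, hbx⟩ := exists_orthonormalBasis_zero hdim
    (by rw [norm_smul, norm_inv, norm_norm, inv_mul_cancel₀ hs.ne'] : ‖s⁻¹ • z.fst‖ = 1)
  obtain ⟨b, hb0, hb1⟩ := exists_orthonormalBasis_zero_one hdim hun hnn hunn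
  have hbxn : ∀ i : Fin 7, inner ℝ z.fst (bx i.succ) = 0 := by
    intro i
    have h1 := bx.orthonormal.2 (Fin.succ_ne_zero i).symm
    have h2 : z.fst = s • bx 0 := by
      rw [hbx, smul_smul, mul_inv_cancel₀ hs.ne', one_smul]
    rw [h2, inner_smul_left, h1, mul_zero]
  have hbn : ∀ j : Fin 8, j ≠ 0 → inner ℝ z.snd (b j) = 0 := by
    intro j hj
    rw [hyu, inner_smul_left, ← hb0, b.orthonormal.2 hj.symm, mul_zero]
  -- The pole is `C • u - S • n`, so the other six basis vectors are orthogonal to it.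
  have hbpole : ∀ i : Fin 6, (b i.succ.succ) 0 = 0 := by
    intro i
    have h1 : pole = C • b 0 - S • b 1 := by
      rw [hb0, hb1, hn_def, smul_inv_smul₀ hS.ne', sub_sub_cancel]
    have h2 : (i.succ.succ : Fin 8) ≠ 1 := fun h => Fin.succ_ne_zero i (Fin.succ_injective _ h)
    rw [← inner_pole, h1, inner_sub_left, inner_smul_left, inner_smul_left,
      b.orthonormal.2 (Fin.succ_ne_zero _).symm, b.orthonormal.2 h2.symm]
    simp
  -- the angle `η` along the lines in the second component
  have hang : ∀ j : Fin 8, j ≠ 0 → ∀ t : ℝ,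
      (z.snd + t • b j) 0 / ‖z.snd + t • b j‖ = (c * C + t * b j 0) / √(c ^ 2 + t ^ 2) := by
    intro j hj t
    rw [norm_add_smul_of_inner_eq_zero (b.norm_eq_one j) (hbn j hj), PiLp.add_apply,
      PiLp.smul_apply, smul_eq_mul, ← hc_def, ← hy0]
  have hang0 : ∀ᶠ t : ℝ in 𝓝 0, (z.snd + t • b 0) 0 / ‖z.snd + t • b 0‖ = C := by
    filter_upwards [lt_mem_nhds (neg_lt_zero.2 hc)] with t ht
    rw [hb0, hu_def, norm_add_smul_normalized hy ht, PiLp.add_apply, PiLp.smul_apply,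
      PiLp.smul_apply, ← hc_def, smul_eq_mul, smul_eq_mul, hC_def]
    have : c + t ≠ 0 := by linarith
    field_simp
  have hangn : ∀ᶠ t : ℝ in 𝓝 0, Real.arccos ((z.snd + t • b 1) 0 / ‖z.snd + t • b 1‖) =
      Real.arccos C + Real.arctan (t / c) := by
    filter_upwards [eventually_arccos_rotate hc hC1 hC2] with t ht
    rw [hang 1 (by decide), hb1, hn0, ht]
  -- horizontal and vertical second derivatives
  set D := fderiv ℝ f (radialMap z) with hD_def
  set H := fderiv ℝ (fderiv ℝ f) (radialMap z) with hH_def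
  set e := bx.prod b with he_def
  have hel : ∀ i (t : ℝ), radialMap (z + t • e (Sum.inl i)) =
      (Real.arctan (‖z.fst + t • bx i‖ / c), Real.arccos C) := by
    intro i t
    have h1 : (z + t • e (Sum.inl i)).fst = z.fst + t • bx i := by
      rw [he_def, OrthonormalBasis.prod_apply]; rfl
    have h2 : (z + t • e (Sum.inl i)).snd = z.snd := by
      rw [he_def, OrthonormalBasis.prod_apply]
      change z.snd + t • (0 : Oct) = z.snd
      rw [smul_zero, add_zero]
    rw [radialMap, h1, h2]
  have her : ∀ j (t : ℝ), radialMap (z + t • e (Sum.inr j)) =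
      (Real.arctan (s / ‖z.snd + t • b j‖),
        Real.arccos ((z.snd + t • b j) 0 / ‖z.snd + t • b j‖)) := by
    intro j t
    have h1 : (z + t • e (Sum.inr j)).fst = z.fst := by
      rw [he_def, OrthonormalBasis.prod_apply]
      change z.fst + t • (0 : Oct) = z.fst
      rw [smul_zero, add_zero]
    have h2 : (z + t • e (Sum.inr j)).snd = z.snd + t • b j := by
      rw [he_def, OrthonormalBasis.prod_apply]; rfl
    rw [radialMap, h1, h2]
  -- The displaced point stays on the octonionic line of `z`, so `r` does not change. The factor `c`
  -- is the normalization of `lineVec`, equal to `‖z.snd‖` on the sphere.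
  have hev : ∀ j, ∀ᶠ t : ℝ in 𝓝 0, radialMap (z + t • lineVec (slope z) (b j)) =
      (Real.arctan (s / c),
        Real.arccos ((z.snd + (t * c) • b j) 0 / ‖z.snd + (t * c) • b j‖)) := by
    intro j
    have hne : ∀ᶠ t : ℝ in 𝓝 0, z.snd + (t * c) • b j ≠ 0 := by
      have : ContinuousAt (fun t : ℝ => z.snd + (t * c) • b j) 0 := by fun_prop
      exact this.eventually_ne (by simpa using hy)
    filter_upwards [hne] with t ht
    have h2 : (z + t • lineVec (slope z) (b j)).snd = z.snd + (t * c) • b j := by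
      rw [lineVec, hk, smul_smul]; rfl
    have h1 : (z + t • lineVec (slope z) (b j)).fst =
        octMul (z.snd + (t * c) • b j) (slope z) := by
      rw [octMul_add_left, ← fst_eq_octMul_slope hy, octMul_smul_left, lineVec, hk, smul_smul]
      rfl
    rw [radialMap, h1, h2, norm_octMul, mul_div_cancel_left₀ _ (norm_ne_zero_iff.2 ht), hslope]
  have htc : Tendsto (fun t : ℝ => t * c) (𝓝 0) (𝓝 0) := by
    have : ContinuousAt (fun t : ℝ => t * c) 0 := by fun_prop
    simpa [ContinuousAt] using this
  -- `t1` and `t3` are the directions along `x` and `y`, `t2` the seven orthogonal to `x`, `t4` the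
  -- rotation towards `n`, `t5` the six remaining ones; `v1`, `v2`, `v3` are their vertical
  -- counterparts of `t3`, `t4`, `t5`.
  have t1 : fderiv ℝ (fderiv ℝ F) z (e (Sum.inl 0)) (e (Sum.inl 0)) =
      H (c, 0) (c, 0) + D (-(2 * s * c), 0) := by
    refine hess_line_of_radialMap hF hFf hf (hasTwoJet_arctan_add_div hc hsc)
      (hasTwoJet_const (Real.arccos C)) ?_
    filter_upwards [lt_mem_nhds (neg_lt_zero.2 hs)] with t ht
    rw [hel, hbx, norm_add_smul_normalized hx ht]
  have t2 : ∀ i : Fin 7, fderiv ℝ (fderiv ℝ F) z (e (Sum.inl i.succ)) (e (Sum.inl i.succ)) =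
      H (0, 0) (0, 0) + D (c / s, 0) := by
    intro i
    refine hess_line_of_radialMap hF hFf hf (hasTwoJet_arctan_sqrt_div hs hc hsc)
      (hasTwoJet_const (Real.arccos C)) (Eventually.of_forall fun t => ?_)
    rw [hel, norm_add_smul_of_inner_eq_zero (bx.norm_eq_one _) (hbxn i), one_mul]
  have t3 : fderiv ℝ (fderiv ℝ F) z (e (Sum.inr 0)) (e (Sum.inr 0)) =
      H (-s, 0) (-s, 0) + D (2 * s * c, 0) := by
    refine hess_line_of_radialMap hF hFf hf (hasTwoJet_arctan_div_add hs hc hsc)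
      (hasTwoJet_const (Real.arccos C)) ?_
    filter_upwards [lt_mem_nhds (neg_lt_zero.2 hc), hang0] with t ht ht2
    rw [her, ht2, hb0, hu_def, norm_add_smul_normalized hy ht]
  have t4 : fderiv ℝ (fderiv ℝ F) z (e (Sum.inr 1)) (e (Sum.inr 1)) =
      H (0, 1 / c) (0, 1 / c) + D (-(s / c), 0) := by
    refine hess_line_of_radialMap hF hFf hf (hasTwoJet_arctan_div_sqrt hc hsc)
      (hasTwoJet_add_arctan (Real.arccos C) (1 / c)) ?_
    filter_upwards [hangn] with t ht
    rw [her, ht, norm_add_smul_of_inner_eq_zero (b.norm_eq_one _) (hbn 1 (by decide)), one_mul,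
      mul_one_div]
  have t5 : ∀ i : Fin 6,
      fderiv ℝ (fderiv ℝ F) z (e (Sum.inr i.succ.succ)) (e (Sum.inr i.succ.succ)) =
      H (0, 0) (0, 0) + D (-(s / c), 1 * (C / (c ^ 2 * S))) := by
    intro i
    refine hess_line_of_radialMap hF hFf hf (hasTwoJet_arctan_div_sqrt hc hsc)
      (hasTwoJet_arccos_div_sqrt hc hC1 hC2 1) (Eventually.of_forall fun t => ?_)
    rw [her, hang _ (Fin.succ_ne_zero _), hbpole, mul_zero, add_zero,
      norm_add_smul_of_inner_eq_zero (b.norm_eq_one _) (hbn _ (Fin.succ_ne_zero _)), one_mul]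
  have v1 : fderiv ℝ (fderiv ℝ F) z (lineVec (slope z) (b 0)) (lineVec (slope z) (b 0)) =
      H (0, 0) (0, 0) + D (0, 0) := by
    refine hess_line_of_radialMap hF hFf hf (hasTwoJet_const (Real.arctan (s / c)))
      (hasTwoJet_const (Real.arccos C)) ?_
    filter_upwards [hev 0, htc.eventually hang0] with t ht1 ht2
    rw [ht1, ht2]
  have v2 : fderiv ℝ (fderiv ℝ F) z (lineVec (slope z) (b 1)) (lineVec (slope z) (b 1)) =
      H (0, 1) (0, 1) + D (0, 0) := by
    refine hess_line_of_radialMap hF hFf hf (hasTwoJet_const (Real.arctan (s / c)))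
      (hasTwoJet_add_arctan (Real.arccos C) 1) ?_
    filter_upwards [hev 1, htc.eventually hangn] with t ht1 ht2
    rw [ht1, ht2, mul_div_cancel_right₀ _ hc.ne', mul_one]
  have v3 : ∀ i : Fin 6, fderiv ℝ (fderiv ℝ F) z (lineVec (slope z) (b i.succ.succ))
      (lineVec (slope z) (b i.succ.succ)) =
      H (0, 0) (0, 0) + D (0, c ^ 2 * (C / (c ^ 2 * S))) := by
    intro i
    refine hess_line_of_radialMap hF hFf hf (hasTwoJet_const (Real.arctan (s / c)))
      (hasTwoJet_arccos_div_sqrt hc hC1 hC2 (c ^ 2)) ?_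
    filter_upwards [hev i.succ.succ] with t ht1
    rw [ht1, hang _ (Fin.succ_ne_zero _), hbpole, mul_zero, add_zero, mul_pow, mul_comm (t ^ 2)]
  obtain ⟨d₁, hd₁⟩ : ∃ d, D (1, 0) = d := ⟨_, rfl⟩
  obtain ⟨d₂, hd₂⟩ : ∃ d, D (0, 1) = d := ⟨_, rfl⟩
  obtain ⟨h₁, hh₁⟩ : ∃ h, H (1, 0) (1, 0) = h := ⟨_, rfl⟩
  obtain ⟨h₂, hh₂⟩ : ∃ h, H (0, 1) (0, 1) = h := ⟨_, rfl⟩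
  have hDlin : ∀ p q : ℝ, D (p, q) = p * d₁ + q * d₂ := by
    intro p q
    rw [← hd₁, ← hd₂, ← smul_eq_mul, ← smul_eq_mul, ← map_smul, ← map_smul, ← map_add]
    simp
  have hHlin1 : ∀ p : ℝ, H (p, 0) (p, 0) = p ^ 2 * h₁ := by
    intro p
    rw [← hh₁, show ((p, 0) : ℝ × ℝ) = p • (1, 0) by simp, map_smul, map_smul, smul_apply]
    simp only [smul_eq_mul]
    ring
  have hHlin2 : ∀ p : ℝ, H (0, p) (0, p) = p ^ 2 * h₂ := by
    intro p
    rw [← hh₂, show ((0, p) : ℝ × ℝ) = p • (0, 1) by simp, map_smul, map_smul, smul_apply]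
    simp only [smul_eq_mul]
    ring
  have hcotr : Real.cot (Real.arctan (s / c)) = c / s := by
    rw [← inv_inv (Real.cot _), Real.cot_inv_eq_tan, Real.tan_arctan, inv_div]
  have hcotη : Real.cot (Real.arccos C) = C / S := by
    rw [Real.cot_eq_cos_div_sin, Real.cos_arccos hC1.le hC2.le, Real.sin_arccos]
  rw [subLaplacian_eq_sum hz hy hgF hF hhom e b, Fintype.sum_sum_type, Fin.sum_univ_succ,
    Fin.sum_univ_succ (fun j => fderiv ℝ (fderiv ℝ F) z (e (Sum.inr j)) (e (Sum.inr j))),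
    Fin.sum_univ_succ (fun j : Fin 7 => fderiv ℝ (fderiv ℝ F) z (e (Sum.inr j.succ)) _),
    Fin.sum_univ_succ (fun j => fderiv ℝ (fderiv ℝ F) z (lineVec (slope z) (b j)) _),
    Fin.sum_univ_succ (fun j : Fin 7 =>
      fderiv ℝ (fderiv ℝ F) z (lineVec (slope z) (b j.succ)) _),
    radialOp_eq hf, ← hD_def, ← hH_def, hrad]
  simp only [Fin.succ_zero_eq_one, t1, t2, t3, t4, t5, v1, v2, v3, Finset.sum_const,
    Finset.card_univ, Fintype.card_fin, nsmul_eq_mul, hcotr, hcotη, Real.tan_arctan]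
  simp only [hDlin, hHlin1, hHlin2]
  push_cast
  -- Both `η`-terms occur with `1 / c ^ 2` in the full trace and with `1` in the vertical one; the
  -- difference is `tan² r`. The first order terms `±2 s c` cancel, and `s² + c² = 1` normalizes the
  -- coefficient of `h₁`.
  have hsc2 : (s / c) ^ 2 = 1 / c ^ 2 - 1 := by
    field_simp
    linarith
  rw [hsc2, show C / (c ^ 2 * S) = 1 / c ^ 2 * (C / S) by field_simp,
    show c ^ 2 * (1 / c ^ 2 * (C / S)) = C / S by field_simp]
  linear_combination h₁ * hsc

/-! ### Homogeneous extension and the identity for test functions. -/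

/-- The extension of a function on the unit sphere that is homogeneous of degree zero. -/
def homExt {E : Type*} [NormedAddCommGroup E] [NormedSpace ℝ E] (g : E → ℝ) (x : E) : ℝ :=
  g (‖x‖⁻¹ • x)

section HomExt

variable {E : Type*} [NormedAddCommGroup E] [InnerProductSpace ℝ E] {g : E → ℝ}

theorem eq_homExt {x : E} (hx : ‖x‖ = 1) : g x = homExt g x := by
  simp [homExt, hx]

theorem homExt_smul (x : E) {t : ℝ} (ht : 0 < t) : homExt g (t • x) = homExt g x := by
  rw [homExt, homExt, norm_smul, Real.norm_of_nonneg ht.le, smul_smul, mul_inv, mul_right_comm,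
    inv_mul_cancel₀ ht.ne', one_mul]

theorem contDiffAt_homExt {x : E} (hx : ‖x‖ = 1)
    (hg : ContDiffWithinAt ℝ 2 g (Metric.sphere 0 1) x) : ContDiffAt ℝ 2 (homExt g) x := by
  have h0 : x ≠ 0 := by
    rintro rfl
    simp at hx
  have hN : ContDiffAt ℝ 2 (fun x : E => ‖x‖⁻¹ • x) x :=
    ((contDiffAt_norm ℝ h0).inv (norm_ne_zero_iff.2 h0)).smul contDiffAt_id
  have hNx : ‖x‖⁻¹ • x = x := by simp [hx]
  refine ContDiffWithinAt.contDiffAt (s := {0}ᶜ) ?_ (isOpen_compl_singleton.mem_nhds h0)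
  refine ContDiffWithinAt.comp (f := fun x : E => ‖x‖⁻¹ • x) (t := Metric.sphere 0 1) x
    (by rwa [hNx]) hN.contDiffWithinAt fun y hy => ?_
  have : ‖y‖ ≠ 0 := norm_ne_zero_iff.2 hy
  simp [norm_smul, this]

end HomExt

theorem isOpen_radialInterior : IsOpen radialInterior := isOpen_Ioo.prod isOpen_Ioo

theorem radialInterior_subset : radialInterior ⊆ radialDomain :=
  prod_mono Ioo_subset_Ico_self Ioo_subset_Ico_self

theorem contDiffAt_of_mem_testFunctions {f : ℝ × ℝ → ℝ} (hf : f ∈ testFunctions) {q : ℝ × ℝ}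
    (hq : q ∈ radialInterior) : ContDiffAt ℝ 2 f q :=
  ((hf.1.mono radialInterior_subset).contDiffAt (isOpen_radialInterior.mem_nhds hq)).of_le
    (WithTop.coe_le_coe.2 le_top)

variable (Y : OrthonormalBasis (Fin 7) ℝ (tangent S7 pole))

theorem subLaplacian_comp_psi {f : ℝ × ℝ → ℝ} (hf : f ∈ testFunctions) {z : Oct2}
    (hz : z ∈ Omega) (hq : psi Y z ∈ radialInterior) :
    subLaplacian (f ∘ psi Y) z = radialOp f (psi Y z) := by
  have hf2 := contDiffAt_of_mem_testFunctions hf hq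
  rw [psi_eq_radialMap Y hz] at hq hf2 ⊢
  refine subLaplacian_radial hz.1 hq hf2 (fun x hx => eq_homExt hx)
    (fun t ht => homExt_smul z ht) ?_
  -- Normalizing a point of the open cone over `Ω` lands in `Ω`, where `ψ` is `radialMap`, which is
  -- itself invariant under scaling.
  filter_upwards [isOpen_omegaCone.mem_nhds ⟨hz.2.1, hz.2.2⟩] with x hx
  rw [homExt, Function.comp_apply, psi_normalize Y hx, Function.comp_apply]

/-! ### Sections of `ψ` and the limit at `r = 0` or `η = 0`. -/

/-- The surface of points with components in the directions of `x` and of `pole` and `n`. -/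
def radialSection (x n : Oct) (q : ℝ × ℝ) : Oct2 :=
  WithLp.toLp 2 (Real.sin q.1 • x, Real.cos q.1 • (Real.cos q.2 • pole + Real.sin q.2 • n))

theorem continuous_radialSection (x n : Oct) : Continuous (radialSection x n) := by
  unfold radialSection
  fun_prop

theorem radialSection_spec {x n : Oct} (hx : ‖x‖ = 1) (hn : ‖n‖ = 1) (hn0 : n 0 = 0) {q : ℝ × ℝ}
    (hq : q ∈ radialDomain) :
    radialSection x n q ∈ Omega ∧ radialMap (radialSection x n q) = q := by
  obtain ⟨⟨hr1, hr2⟩, hη1, hη2⟩ := hq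
  have hcos : 0 < Real.cos q.1 := Real.cos_pos_of_mem_Ioo ⟨by linarith [Real.pi_pos], hr2⟩
  have hsin : 0 ≤ Real.sin q.1 := Real.sin_nonneg_of_nonneg_of_le_pi hr1
    (by linarith [Real.pi_pos])
  set w : Oct := Real.cos q.2 • pole + Real.sin q.2 • n with hw
  have hwn : ‖w‖ = 1 := by
    rw [← sq_eq_sq₀ (norm_nonneg _) zero_le_one, hw, norm_add_sq_real, inner_smul_left,
      inner_smul_right, inner_pole, hn0, norm_smul, norm_smul, hn, norm_pole, Real.norm_eq_abs,
      Real.norm_eq_abs, mul_one, mul_one, sq_abs, sq_abs]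
    linarith [Real.sin_sq_add_cos_sq q.2]
  have hw0 : w 0 = Real.cos q.2 := by simp [hw, hn0, pole]
  have h1 : (radialSection x n q).fst = Real.sin q.1 • x := rfl
  have h2 : (radialSection x n q).snd = Real.cos q.1 • w := rfl
  have h1n : ‖(radialSection x n q).fst‖ = Real.sin q.1 := by
    rw [h1, norm_smul, hx, mul_one, Real.norm_of_nonneg hsin]
  have h2n : ‖(radialSection x n q).snd‖ = Real.cos q.1 := by
    rw [h2, norm_smul, hwn, mul_one, Real.norm_of_nonneg hcos.le]
  refine ⟨⟨?_, ?_, ?_⟩, ?_⟩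
  · rw [S15, mem_sphere_zero_iff_norm, ← sq_eq_sq₀ (norm_nonneg _) zero_le_one, norm_sq_oct2,
      h1n, h2n]
    linarith [Real.sin_sq_add_cos_sq q.1]
  · rw [← norm_ne_zero_iff, h2n]
    exact hcos.ne'
  · rw [h2n, h2, smul_smul, inv_mul_cancel₀ hcos.ne', one_smul]
    intro h
    have h3 : Real.cos q.2 = -1 := by
      rw [← hw0, h]; simp [pole]
    have h4 := Real.arccos_cos hη1 hη2.le
    rw [h3, Real.arccos_neg_one] at h4
    exact hη2.ne h4.symm
  · rw [radialMap, h1n, h2n, h2, PiLp.smul_apply, smul_eq_mul, hw0,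
      mul_div_cancel_left₀ _ hcos.ne', Real.arccos_cos hη1 hη2.le, ← Real.tan_eq_sin_div_cos,
      Real.arctan_tan (by linarith [Real.pi_pos]) hr2]

theorem exists_unit_smul_eq (x : Oct) : ∃ u : Oct, ‖u‖ = 1 ∧ x = ‖x‖ • u := by
  rcases eq_or_ne x 0 with rfl | hx
  · exact ⟨pole, norm_pole, by simp⟩
  · have := norm_ne_zero_iff.2 hx
    exact ⟨‖x‖⁻¹ • x, by simp [norm_smul, this], by rw [smul_inv_smul₀ this]⟩

theorem exists_unit_ortho_smul_eq {x : Oct} (hx : x 0 = 0) :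
    ∃ u : Oct, ‖u‖ = 1 ∧ u 0 = 0 ∧ x = ‖x‖ • u := by
  rcases eq_or_ne x 0 with rfl | h
  · exact ⟨EuclideanSpace.single 1 1, by simp, by simp, by simp⟩
  · have := norm_ne_zero_iff.2 h
    exact ⟨‖x‖⁻¹ • x, by simp [norm_smul, this], by simp [hx], by rw [smul_inv_smul₀ this]⟩

/-- Take `x` and `n` to be the directions of the first component and of the part of the second
orthogonal to the pole. Where one of these vanishes, its direction is arbitrary because its
coefficient `sin r` or `sin η` is zero. -/
theorem exists_radialSection_eq {z : Oct2} (hz : z ∈ Omega) :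
    ∃ x n : Oct, ‖x‖ = 1 ∧ ‖n‖ = 1 ∧ n 0 = 0 ∧ radialSection x n (radialMap z) = z := by
  obtain ⟨h15, h2, -⟩ := hz
  have hc : 0 < ‖z.snd‖ := norm_pos_iff.2 h2
  have hsc : ‖z.fst‖ ^ 2 + ‖z.snd‖ ^ 2 = 1 := by
    rw [← norm_sq_oct2, show ‖z‖ = 1 by simpa [S15] using h15]; norm_num
  obtain ⟨x, hx, hzx⟩ := exists_unit_smul_eq z.fst
  set C := z.snd 0 / ‖z.snd‖ with hC
  obtain ⟨n, hn, hn0, hzn⟩ := exists_unit_ortho_smul_eq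
    (x := ‖z.snd‖⁻¹ • z.snd - C • pole) (by simp [pole, hC]; ring)
  have hCn : C ^ 2 + ‖‖z.snd‖⁻¹ • z.snd - C • pole‖ ^ 2 = 1 := by
    have h1 : ‖‖z.snd‖⁻¹ • z.snd‖ = 1 := by simp [norm_smul, hc.ne']
    rw [norm_sub_sq_real, h1, inner_smul_left, inner_smul_right, real_inner_comm, inner_pole,
      norm_smul, norm_pole, mul_one, Real.norm_eq_abs, sq_abs, hC]
    simp
    field_simp
    ring
  have hsqrt : √(1 + (‖z.fst‖ / ‖z.snd‖) ^ 2) = 1 / ‖z.snd‖ := by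
    rw [Real.sqrt_eq_iff_eq_sq (by positivity) (by positivity)]
    field_simp
    linarith
  have hsinr : Real.sin (radialMap z).1 = ‖z.fst‖ := by
    rw [radialMap, Real.sin_arctan, hsqrt]
    field_simp
  have hcosr : Real.cos (radialMap z).1 = ‖z.snd‖ := by
    rw [radialMap, Real.cos_arctan, hsqrt, one_div_one_div]
  have hsinη : Real.sin (radialMap z).2 = ‖‖z.snd‖⁻¹ • z.snd - C • pole‖ := by
    rw [radialMap, Real.sin_arccos, ← hC, ← hCn, add_sub_cancel_left,
      Real.sqrt_sq (norm_nonneg _)]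
  have hcosη : Real.cos (radialMap z).2 = C := by
    rw [radialMap, Real.cos_arccos] <;> nlinarith [sq_nonneg (‖‖z.snd‖⁻¹ • z.snd - C • pole‖)]
  refine ⟨x, n, hx, hn, hn0, ?_⟩
  rw [radialSection, hsinr, hcosr, hsinη, hcosη, ← hzx, ← hzn, add_sub_cancel,
    smul_inv_smul₀ hc.ne']
  rfl

theorem tendsto_radialOp {f : ℝ × ℝ → ℝ} (hf : f ∈ testFunctions) {z : Oct2} (hz : z ∈ Omega)
    (hC : ContDiffWithinAt ℝ 2 (f ∘ psi Y) S15 z) :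
    Tendsto (radialOp f) (𝓝[radialInterior] (psi Y z)) (𝓝 (subLaplacian (f ∘ psi Y) z)) := by
  set g := f ∘ psi Y
  have hz1 : ‖z‖ = 1 := by simpa [S15] using hz.1
  have hF : ContDiffAt ℝ 2 (homExt g) z := contDiffAt_homExt hz1 hC
  set H := fderiv ℝ (fderiv ℝ (homExt g)) with hH
  have hHc : ContinuousAt H z :=
    ((hF.fderiv_right (m := 1) (by norm_num)).fderiv_right (m := 0) (by norm_num)).continuousAt
  set e := stdOrthonormalBasis ℝ Oct2
  set b := EuclideanSpace.basisFun (Fin 8) ℝ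
  have hL : ∀ {z' : Oct2}, z' ∈ Omega → ContDiffAt ℝ 2 (homExt g) z' → subLaplacian g z' =
      ∑ k, H z' (e k) (e k) - ∑ j, H z' (lineVec (slope z') (b j)) (lineVec (slope z') (b j)) :=
    fun hz' hF' => subLaplacian_eq_sum hz'.1 hz'.2.1 (fun x hx => eq_homExt hx) hF'
      (fun t ht => homExt_smul _ ht) e b
  -- The vertical frame must vary continuously with the point; `lineVec` over a fixed basis of `𝕆`
  -- does, since the slope is continuous where the second component is nonzero.
  have hcont : ContinuousAt (fun z' => ∑ k, H z' (e k) (e k) -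
      ∑ j, H z' (lineVec (slope z') (b j)) (lineVec (slope z') (b j))) z := by
    have hl : ∀ j, ContinuousAt (fun z' => lineVec (slope z') (b j)) z := fun j =>
      ContinuousAt.comp (f := slope) (continuous_lineVec (b j)).continuousAt
        (continuousAt_slope hz.2.1)
    refine ContinuousAt.sub (tendsto_finsetSum _ fun k _ => ?_) (tendsto_finsetSum _ fun j _ => ?_)
    · exact (hHc.clm_apply continuousAt_const).clm_apply continuousAt_const
    · exact (hHc.clm_apply (hl j)).clm_apply (hl j)
  obtain ⟨x, n, hx, hn, hn0, hsec⟩ := exists_radialSection_eq hz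
  rw [← psi_eq_radialMap Y hz] at hsec
  have hσ : Tendsto (radialSection x n) (𝓝[radialInterior] (psi Y z)) (𝓝 z) := by
    have := (continuous_radialSection x n).continuousAt (x := psi Y z)
    rw [ContinuousAt, hsec] at this
    exact this.mono_left nhdsWithin_le_nhds
  rw [hL hz hF]
  refine (hcont.tendsto.comp hσ).congr' ?_
  -- Being `C²` at `z` persists nearby, so close to `ψ(z)` the trace formula also computes `L` at
  -- the section points, where it equals `radialOp f`.
  filter_upwards [hσ.eventually (hF.eventually (by simp)), self_mem_nhdsWithin] with q hq1 hq2
  obtain ⟨h1, h2⟩ := radialSection_spec hx hn hn0 (radialInterior_subset hq2)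
  have h3 : psi Y (radialSection x n q) = q := by rw [psi_eq_radialMap Y h1, h2]
  rw [Function.comp_apply, ← hL h1 hq1, subLaplacian_comp_psi Y hf h1 (by rwa [h3]), h3]

theorem exists_psi_eq {q : ℝ × ℝ} (hq : q ∈ radialDomain) : ∃ z ∈ Omega, psi Y z = q := by
  obtain ⟨h1, h2⟩ := radialSection_spec norm_pole (n := EuclideanSpace.single 1 1) (by simp)
    (by simp) hq
  exact ⟨_, h1, by rw [psi_eq_radialMap Y h1, h2]⟩

end OctonionicHopf

end

open OctonionicHopf in
theorem mainTheorem4 (Y : OrthonormalBasis (Fin 7) ℝ (tangent S7 pole)) :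
    (∀ T : (ℝ × ℝ → ℝ) → ℝ × ℝ → ℝ,
      IsRadialPart Y T ↔ ∀ f ∈ testFunctions, EqOn (T f) (radialOp f) radialInterior) ∧
    (∀ f ∈ testFunctions, ∀ z ∈ Omega, ContDiffWithinAt ℝ 2 (f ∘ psi Y) S15 z →
      Tendsto (radialOp f) (𝓝[radialInterior] (psi Y z)) (𝓝 (subLaplacian (f ∘ psi Y) z))) := by
  refine ⟨fun T => ⟨fun hT f hf q hq => ?_, fun hT f hf z hz hq => ?_⟩,
    fun f hf z hz hC => tendsto_radialOp Y hf hz hC⟩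
  · obtain ⟨z, hz, rfl⟩ := exists_psi_eq Y (radialInterior_subset hq)
    rw [← hT f hf z hz hq, subLaplacian_comp_psi Y hf hz hq]
  · rw [hT f hf hq, subLaplacian_comp_psi Y hf hz hq]
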